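/- **Setting.** Let $p$ be a probability distribution on a set $\mathcal I$ of tasks. Each task $i$ has a loss $f_i:\mathbb R^d\to\mathbb R$ and a data distribution $P_i$, and for a data point $\theta\sim P_i$ a stochastic gradient $\tilde\nabla f_i(w,\theta)\in\mathbb R^d$. For a dataset $\mathcal D$ put $\tilde\nabla f_i(w,\mathcal D)=\frac1{|\mathcal D|}\sum_{\theta\in\mathcal D}\tilde\nabla f_i(w,\theta)$. For $\alpha>0$ let $$F(w)=\mathbb E_{i\sim p}\big[f_i(w-\alpha\nabla f_i(w))\big].$$ Assume, with constants $L>0$, $\rho\ge0$, $\sigma>0$, $\tilde\sigma\ge0$, that $f_i(w)$ and $\nabla f_i(w)$ have finite expectations over $i\sim p$ for every $w$ and that: 1. $F$ is bounded below; 2. every $f_i$ is twice continuously differentiable with $L$-Lipschitz gradient and $\rho$-Lipschitz Hessian (in operator norm); 3. $\mathbb E_{i\sim p}\|\mathbb E_{j\sim p}[\nabla f_j(w)]-\nabla f_i(w)\|^2\le\sigma^2$ for every $w$; 4. $\mathbb E_{\theta\sim P_i}[\tilde\nabla f_i(w,\theta)]=\nabla f_i(w)$ and $\mathbb E_{\theta\sim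 P_i}\|\tilde\nabla f_i(w,\theta)-\nabla f_i(w)\|^2\le\tilde\sigma^2$ for every $i$ and $w$. **FO-MAML.** Let $w_0\in\mathbb R^d$ be deterministic. In iteration $k$, draw a batch $\mathcal B_k$ of $B$ i.i.d. tasks from $p$ and, for each drawn task, independent datasets $\mathcal D^i_{in}$, $\mathcal D^i_{o}$ of $D_{in}$ and $D_o$ i.i.d. points from $P_i$. Independently, draw a batch $\mathcal B'_k$ of $B'$ i.i.d. tasks from $p$ with datasets $\mathcal D_\beta^j$ of $D_\beta$ i.i.d. points from $P_j$. All draws are independent of those of other iterations. Then $$w_{k+1}=w_k-\frac{\beta_k}{B}\sum_{i\in\mathcal B_k}\tilde\nabla f_i\big(w_k-\alpha\tilde\nabla f_i(w_k,\mathcal D^i_{in}),\mathcal D^i_{o}\big),\qquad \beta_k=\frac1{18}\Big(4L+\frac{2\rho\alpha}{B'}\sum_{j\in\mathcal B'_k}\|\tilde\nabla f_j(w_k,\mathcal D^j_\beta)\|\Big)^{-1}.$$ **Statement.** For all $K,C_1,C_2>0$ there is a constant $C>0$, depending only on $K$, $C_1$ and $C_2$, such that the following holds in every such setting. Suppose that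 $0<\alpha\le\frac1{10L}$, $\rho\alpha/L\le K$ and $\sigma^2+\tilde\sigma^2\le K$, and that the batch sizes are positive integers with $B'\ge\lceil\frac12(\rho\alpha\sigma/L)^2\rceil$, $D_\beta\ge\lceil(2\rho\alpha\tilde\sigma/L)^2\rceil$, $B\ge20$ and $$B\ge C_1\frac1{\alpha^2L^2},\qquad D_{in}\ge C_2\frac{\tilde\sigma^2}{\alpha^2\sigma^2L^2},\qquad BD_o\ge C_2\frac{\tilde\sigma^2}{\alpha^2\sigma^2L^2}.$$ Then $F$ is differentiable and, with $\Delta=F(w_0)-\inf_wF(w)$, there is an iteration index $$k\le \Delta\cdot C\,\frac1{\alpha^2\sigma^2L}\qquad\text{with}\qquad \mathbb E\|\nabla F(w_k)\|\le C\,\alpha\sigma L .$$ -/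

import Mathlib

open MeasureTheory ProbabilityTheory

noncomputable section

namespace FOMAML

/-- The parameter space `ℝ^d` with its Euclidean norm. -/
abbrev Param (d : ℕ) : Type := EuclideanSpace ℝ (Fin d)

section Objective

variable {d : ℕ} {I : Type*} [MeasurableSpace I]

/-- The loss of one task after one exact gradient step: `F_i(w) = f_i(w - α ∇f_i(w))`. -/
def adaptedLoss (f : I → Param d → ℝ) (α : ℝ) (i : I) (w : Param d) : ℝ :=
  f i (w - α • gradient (f i) w)

/-- The meta-objective `F(w) = 𝔼_{i ∼ p} [f_i(w - α ∇f_i(w))]`. -/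
def metaObjective (p : Measure I) (f : I → Param d → ℝ) (α : ℝ) (w : Param d) : ℝ :=
  ∫ i, adaptedLoss f α i w ∂p

end Objective

section Algorithm

variable {d : ℕ} {I Θ : Type*}

/-- The stochastic gradient of task `i` at `w` on the dataset `D` of size `n`:
the average of the stochastic gradients `g i w θ` over the data points `θ` of `D`. -/
def batchGrad (g : I → Param d → Θ → Param d) (i : I) (w : Param d) {n : ℕ}
    (D : Fin n → Θ) : Param d :=
  (n : ℝ)⁻¹ • ∑ j, g i w (D j)

/-- What is drawn for one member of the task batch: the task, the inner dataset and the
outer dataset. -/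
abbrev MetaDraw (I Θ : Type*) (Din Dout : ℕ) : Type _ :=
  I × ((Fin Din → Θ) × (Fin Dout → Θ))

/-- What is drawn for one member of the batch that tunes the stepsize: the task and one dataset. -/
abbrev StepsizeDraw (I Θ : Type*) (Dβ : ℕ) : Type _ :=
  I × (Fin Dβ → Θ)

/-- What is drawn in one iteration: a batch of `B` tasks with their datasets, and a batch of
`B'` tasks with their datasets for the stepsize. -/
abbrev IterDraw (I Θ : Type*) (B Din Dout B' Dβ : ℕ) : Type _ :=
  (Fin B → MetaDraw I Θ Din Dout) × (Fin B' → StepsizeDraw I Θ Dβ)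

/-- The first-order direction contributed by one drawn task: the stochastic gradient on the outer
dataset, at the point reached by one stochastic gradient step on the inner dataset. -/
def foDirection (g : I → Param d → Θ → Param d) (α : ℝ) {Din Dout : ℕ} (w : Param d)
    (s : MetaDraw I Θ Din Dout) : Param d :=
  batchGrad g s.1 (w - α • batchGrad g s.1 w s.2.1) s.2.2

/-- The estimate `4L + (2ρα/B') ∑_j ‖∇̃f_j(w, D_β^j)‖` of the local smoothness of `F` at `w`. -/
def smoothnessEstimate (g : I → Param d → Θ → Param d) (α L ρ : ℝ) {B' Dβ : ℕ} (w : Param d)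
    (s : Fin B' → StepsizeDraw I Θ Dβ) : ℝ :=
  4 * L + 2 * ρ * α / (B' : ℝ) * ∑ b, ‖batchGrad g (s b).1 w (s b).2‖

/-- The stepsize `β = β̃(w)/18`, where `β̃(w)` is the inverse of the smoothness estimate. -/
def stepsize (g : I → Param d → Θ → Param d) (α L ρ : ℝ) {B' Dβ : ℕ} (w : Param d)
    (s : Fin B' → StepsizeDraw I Θ Dβ) : ℝ :=
  (smoothnessEstimate g α L ρ w s)⁻¹ / 18

/-- One iteration of FO-MAML from `w` with the draws `s`. -/
def foStep (g : I → Param d → Θ → Param d) (α L ρ : ℝ) {B Din Dout B' Dβ : ℕ} (w : Param d)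
    (s : IterDraw I Θ B Din Dout B' Dβ) : Param d :=
  w - (stepsize g α L ρ w s.2 / (B : ℝ)) • ∑ b, foDirection g α w (s.1 b)

/-- The iterates of FO-MAML started at `w₀`, when `s k` is drawn in iteration `k`. -/
def foIterate (g : I → Param d → Θ → Param d) (α L ρ : ℝ) {B Din Dout B' Dβ : ℕ}
    (w₀ : Param d) (s : ℕ → IterDraw I Θ B Din Dout B' Dβ) : ℕ → Param d
  | 0 => w₀
  | k + 1 => foStep g α L ρ (foIterate g α L ρ w₀ s k) (s k)

end Algorithm

section Sampling

variable {I Θ : Type*} [MeasurableSpace I] [MeasurableSpace Θ]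

theorem measurable_pi_kernel (P : Kernel I Θ) [IsMarkovKernel P] (n : ℕ) :
    Measurable fun i : I => Measure.pi fun _ : Fin n => P i := by
  refine Measurable.measure_of_isPiSystem_of_isProbabilityMeasure
    (generateFrom_pi (α := fun _ : Fin n => Θ)).symm isPiSystem_pi ?_
  rintro _ ⟨s, hs, rfl⟩
  simp only [Measure.pi_pi]
  exact Finset.measurable_prod _ fun j _ => P.measurable_coe (hs j (Set.mem_univ j))

/-- A dataset of `n` independent data points of the task `i`, each with law `P i`. -/
def datasetKernel (P : Kernel I Θ) [IsMarkovKernel P] (n : ℕ) : Kernel I (Fin n → Θ) where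
  toFun i := Measure.pi fun _ : Fin n => P i
  measurable' := measurable_pi_kernel P n

/-- The law of a `MetaDraw`: the task has law `p` and, given the task, its two datasets are
independent. -/
def metaDrawLaw (p : Measure I) (P : Kernel I Θ) [IsMarkovKernel P] (Din Dout : ℕ) :
    Measure (MetaDraw I Θ Din Dout) :=
  p ⊗ₘ (datasetKernel P Din ×ₖ datasetKernel P Dout)

/-- The law of a `StepsizeDraw`. -/
def stepsizeDrawLaw (p : Measure I) (P : Kernel I Θ) [IsMarkovKernel P] (Dβ : ℕ) :
    Measure (StepsizeDraw I Θ Dβ) :=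
  p ⊗ₘ datasetKernel P Dβ

/-- The law of the draws of one iteration: the `B` members of the task batch are i.i.d., the `B'`
members of the stepsize batch are i.i.d., and the two batches are independent. -/
def iterDrawLaw (p : Measure I) (P : Kernel I Θ) [IsMarkovKernel P] (B Din Dout B' Dβ : ℕ) :
    Measure (IterDraw I Θ B Din Dout B' Dβ) :=
  (Measure.pi fun _ : Fin B => metaDrawLaw p P Din Dout).prod
    (Measure.pi fun _ : Fin B' => stepsizeDrawLaw p P Dβ)

end Sampling

/-- The standing assumptions on the distribution `p` of the tasks, their losses `f`, the laws `P`
of their data, and their stochastic gradients `g i w θ`. -/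
structure Assumptions {d : ℕ} {I Θ : Type*} [MeasurableSpace I] [MeasurableSpace Θ]
    (p : Measure I) (f : I → Param d → ℝ) (P : Kernel I Θ) (g : I → Param d → Θ → Param d)
    (α L ρ σ σt : ℝ) : Prop where
  /-- The expected loss is defined. -/
  measurable_loss : ∀ w, Measurable fun i => f i w
  integrable_loss : ∀ w, Integrable (fun i => f i w) p
  integrable_grad : ∀ w, Integrable (fun i => gradient (f i) w) p
  /-- The meta-objective is bounded below. -/
  bddBelow : BddBelow (Set.range (metaObjective p f α))
  /-- Every loss is twice continuously differentiable, -/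
  contDiff : ∀ i, ContDiff ℝ 2 (f i)
  /-- its gradient is `L`-Lipschitz, -/
  grad_lipschitz : ∀ i w u, ‖gradient (f i) w - gradient (f i) u‖ ≤ L * ‖w - u‖
  /-- and its Hessian is `ρ`-Lipschitz in the operator norm. -/
  hessian_lipschitz : ∀ i w u,
    ‖fderiv ℝ (gradient (f i)) w - fderiv ℝ (gradient (f i)) u‖ ≤ ρ * ‖w - u‖
  /-- The variance over the tasks of the gradients is at most `σ²`. -/
  task_variance : ∀ w,
    ∫⁻ i, ‖(∫ j, gradient (f j) w ∂p) - gradient (f i) w‖ₑ ^ 2 ∂p ≤ ENNReal.ofReal (σ ^ 2)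
  /-- The stochastic gradients are measurable, unbiased, and have variance at most `σt²`. -/
  measurable_sgrad : Measurable fun x : I × Param d × Θ => g x.1 x.2.1 x.2.2
  unbiased : ∀ i w, ∫ θ, g i w θ ∂(P i) = gradient (f i) w
  data_variance : ∀ i w,
    ∫⁻ θ, ‖g i w θ - gradient (f i) w‖ₑ ^ 2 ∂(P i) ≤ ENNReal.ofReal (σt ^ 2)

end FOMAML

end

open MeasureTheory ProbabilityTheory

set_option linter.unusedSectionVars false

/-! Write `x = ‖∇F(w)‖`, `e = E‖∇f_i(w)‖`, `ε = αLσ` and `Λ = 4L + 2ραe`. The gradient of `f_i(w -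
α∇f_i(w))` satisfies at `w` a Lipschitz bound whose constant is affine in `‖∇f_i(w)‖`. Averaging
over the tasks, `F` has at each `w` a global quadratic upper bound with coefficient at most `55/100
Λ` (`metaObjective_le`, `metaObjective_foStep_le`). The stepsize estimates `1/(18Λ)`: with the
prescribed `B'` and `Dβ` its mean is at least a multiple of `1/Λ` and its second moment at most a
multiple of `1/Λ²` (`le_integral_stepsize`, `integral_stepsize_sq_le`). It is independent of the
direction, so the expectations factor.

The first-order direction omits the Hessian term, whose relative size is of order `αL`. The spread
`σ` of the tasks therefore enters the bias only as `αLσ = ε`, which is the accuracy that can be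
reached. The bias is at most `14/100 x` plus a multiple of `ε` (`bias_le`), and the batch sizes keep
the second moment of the averaged direction below a multiple of `x² + ε²` (`direction_sq_le`). One
iteration thus lowers `F` in expectation by a multiple of `x²/Λ`, up to an error of order `ε²/L`.
Since `e` is at most a multiple of `x + σ`, `Λ` is at most `L(a + bx)`; completing a square bounds
`x²/Λ` below by `t(ε/L)x - aε²/L` (`decrease_le`). The decrease is now linear in the gradient norm.

Integrating over `w_k`, which is independent of the draws of iteration `k`, gives `E F(w_{k+1}) +
κ₁ασ E‖∇F(w_k)‖ ≤ E F(w_k) + κ₂α²σ²L`, with `κ₁`, `κ₂` depending on `K`, `C₁`, `C₂` only. The sum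
over the iterations telescopes and `F` is bounded below, so the mean gradient norm cannot exceed
`CασL` at every index in the allowed range (`exists_integral_le`). -/

namespace FOMAML

/-! ### Calculus of the loss after one gradient step -/

section Calculus

variable {E : Type*} [NormedAddCommGroup E] [InnerProductSpace ℝ E] [CompleteSpace E]

/-- The gradient of `w ↦ f (w - α ∇f(w))`, see `hasGradientAt_comp_gradientStep`. -/
noncomputable def adaptedGrad (f : E → ℝ) (α : ℝ) (w : E) : E :=
  gradient f (w - α • gradient f w) -
    α • ContinuousLinearMap.adjoint (fderiv ℝ (gradient f) w) (gradient f (w - α • gradient f w))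

theorem contDiff_gradient {f : E → ℝ} (hf : ContDiff ℝ 2 f) : ContDiff ℝ 1 (gradient f) := by
  have h : gradient f = fun w => (InnerProductSpace.toDual ℝ E).symm (fderiv ℝ f w) := rfl
  rw [h]
  exact (InnerProductSpace.toDual ℝ E).symm.contDiff.comp
    (hf.fderiv_right (m := 1) (by norm_num))

theorem hasGradientAt_comp_gradientStep {f : E → ℝ} (hf : ContDiff ℝ 2 f) (α : ℝ) (w : E) :
    HasGradientAt (fun u => f (u - α • gradient f u)) (adaptedGrad f α w) w := by
  have h1 : HasFDerivAt (gradient f) (fderiv ℝ (gradient f) w) w :=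
    ((contDiff_gradient hf).differentiable (by norm_num) w).hasFDerivAt
  have h2 : HasFDerivAt (fun u : E => u - α • gradient f u)
      (ContinuousLinearMap.id ℝ E - α • fderiv ℝ (gradient f) w) w :=
    (hasFDerivAt_id w).sub (h1.const_smul α)
  have h3 : HasFDerivAt f (fderiv ℝ f (w - α • gradient f w)) (w - α • gradient f w) :=
    (hf.differentiable (by norm_num) _).hasFDerivAt
  rw [hasGradientAt_iff_hasFDerivAt]
  -- The adjoint arises from taking the Riesz representative of the chain rule; symmetry of the
  -- Hessian is not needed.
  have key : InnerProductSpace.toDual ℝ E (adaptedGrad f α w) =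
      (fderiv ℝ f (w - α • gradient f w)).comp
        (ContinuousLinearMap.id ℝ E - α • fderiv ℝ (gradient f) w) := by
    ext v
    simp [adaptedGrad,
      ContinuousLinearMap.adjoint_inner_left, inner_gradient_left]
  rw [key]
  exact h3.comp w h2

/-- A Taylor estimate at a point where the gradient satisfies a Lipschitz bound. -/
theorem abs_sub_sub_inner_le {F : E → ℝ} {G : E → E} (hF : ∀ u, HasGradientAt F (G u) u)
    {Λ : ℝ} (hΛ : 0 ≤ Λ) {w : E} (hG : ∀ u, ‖G u - G w‖ ≤ Λ * ‖u - w‖) (u : E) :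
    |F u - F w - inner ℝ (G w) (u - w)| ≤ Λ * ‖u - w‖ ^ 2 := by
  have h := (convex_closedBall w ‖u - w‖).norm_image_sub_le_of_norm_hasFDerivWithin_le'
    (f := F) (f' := fun v => InnerProductSpace.toDual ℝ E (G v))
    (φ := InnerProductSpace.toDual ℝ E (G w)) (C := Λ * ‖u - w‖) (x := w) (y := u)
    (fun v _ => (hF v).hasFDerivAt.hasFDerivWithinAt)
    (fun v hv => by
      rw [← map_sub, LinearIsometryEquiv.norm_map]
      refine (hG v).trans ?_
      rw [mem_closedBall_iff_norm] at hv
      gcongr)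
    (by simp) (by simp [dist_eq_norm])
  rw [InnerProductSpace.toDual_apply_apply, Real.norm_eq_abs] at h
  linarith [h, sq ‖u - w‖, mul_assoc Λ ‖u - w‖ ‖u - w‖]

variable {f : E → ℝ} {α L ρ : ℝ}

theorem norm_fderiv_gradient_le (hL : 0 ≤ L)
    (hLip : ∀ w u, ‖gradient f w - gradient f u‖ ≤ L * ‖w - u‖) (w : E) :
    ‖fderiv ℝ (gradient f) w‖ ≤ L :=
  norm_fderiv_le_of_lip' ℝ hL (Filter.Eventually.of_forall fun u => hLip u w)

theorem norm_adjoint_fderiv_gradient_apply_le (hL : 0 ≤ L)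
    (hLip : ∀ w u, ‖gradient f w - gradient f u‖ ≤ L * ‖w - u‖) (w v : E) :
    ‖ContinuousLinearMap.adjoint (fderiv ℝ (gradient f) w) v‖ ≤ L * ‖v‖ := by
  refine (ContinuousLinearMap.le_opNorm _ _).trans ?_
  rw [LinearIsometryEquiv.norm_map]
  gcongr
  exact norm_fderiv_gradient_le hL hLip w

theorem norm_gradient_sub_smul_le (hα : 0 ≤ α)
    (hLip : ∀ w u, ‖gradient f w - gradient f u‖ ≤ L * ‖w - u‖) (w v : E) :
    ‖gradient f (w - α • v) - gradient f w‖ ≤ α * L * ‖v‖ := by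
  refine (hLip _ _).trans_eq ?_
  rw [sub_sub_cancel_left, norm_neg, norm_smul, Real.norm_of_nonneg hα]
  ring

theorem norm_gradient_step_le (hα : 0 ≤ α)
    (hLip : ∀ w u, ‖gradient f w - gradient f u‖ ≤ L * ‖w - u‖) (w : E) :
    ‖gradient f (w - α • gradient f w)‖ ≤ (1 + α * L) * ‖gradient f w‖ := by
  have h := norm_gradient_sub_smul_le hα hLip w (gradient f w)
  have h2 := norm_le_norm_add_norm_sub' (gradient f (w - α • gradient f w)) (gradient f w)
  linarith

/-- This is the price of the first-order method: the omitted Hessian term carries a factor `αL`. -/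
theorem norm_adaptedGrad_sub_le (hα : 0 ≤ α) (hL : 0 ≤ L)
    (hLip : ∀ w u, ‖gradient f w - gradient f u‖ ≤ L * ‖w - u‖) (w : E) :
    ‖adaptedGrad f α w - gradient f (w - α • gradient f w)‖ ≤
      α * L * ((1 + α * L) * ‖gradient f w‖) := by
  have h1 := norm_gradient_step_le hα hLip w
  have h2 := norm_adjoint_fderiv_gradient_apply_le hL hLip w (gradient f (w - α • gradient f w))
  rw [adaptedGrad, sub_sub_cancel_left, norm_neg, norm_smul, Real.norm_of_nonneg hα, mul_assoc]
  gcongr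
  exact h2.trans (by gcongr)

theorem norm_adaptedGrad_le (hα : 0 ≤ α) (hL : 0 ≤ L)
    (hLip : ∀ w u, ‖gradient f w - gradient f u‖ ≤ L * ‖w - u‖) (w : E) :
    ‖adaptedGrad f α w‖ ≤ (1 + α * L) ^ 2 * ‖gradient f w‖ := by
  have h1 := norm_adaptedGrad_sub_le hα hL hLip w
  have h2 := norm_gradient_step_le hα hLip w
  have h3 := norm_le_norm_add_norm_sub' (adaptedGrad f α w) (gradient f (w - α • gradient f w))
  linarith

/-- With `A`, `B` the adjoint Hessians at `u`, `w` and `a`, `b` the gradients after the step, `A a -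
B b = A (a - b) + (A - B) b`. The variation of the Hessian meets only `b`, which the gradient at `w`
controls, so the constant depends on `w` alone and serves every `u`. -/
theorem norm_adaptedGrad_sub_adaptedGrad_le (hα : 0 ≤ α) (hL : 0 ≤ L)
    (hLip : ∀ w u, ‖gradient f w - gradient f u‖ ≤ L * ‖w - u‖)
    (hHess : ∀ w u, ‖fderiv ℝ (gradient f) w - fderiv ℝ (gradient f) u‖ ≤ ρ * ‖w - u‖) (w u : E) :
    ‖adaptedGrad f α u - adaptedGrad f α w‖ ≤
      ((1 + α * L) ^ 2 * L + α * ρ * (1 + α * L) * ‖gradient f w‖) * ‖u - w‖ := by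
  set a := gradient f (u - α • gradient f u) with ha
  set b := gradient f (w - α • gradient f w) with hb
  have hab : ‖a - b‖ ≤ (1 + α * L) * L * ‖u - w‖ := by
    refine (hLip _ _).trans ?_
    have h : ‖u - α • gradient f u - (w - α • gradient f w)‖ ≤ (1 + α * L) * ‖u - w‖ := by
      rw [show u - α • gradient f u - (w - α • gradient f w) =
        (u - w) - α • (gradient f u - gradient f w) by rw [smul_sub]; abel]
      refine (norm_sub_le _ _).trans ?_
      rw [norm_smul, Real.norm_of_nonneg hα]
      have := mul_le_mul_of_nonneg_left (hLip u w) hα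
      linarith
    calc L * _ ≤ L * ((1 + α * L) * ‖u - w‖) := by gcongr
      _ = _ := by ring
  have hbn : ‖b‖ ≤ (1 + α * L) * ‖gradient f w‖ := norm_gradient_step_le hα hLip w
  set A := ContinuousLinearMap.adjoint (fderiv ℝ (gradient f) u)
  set B := ContinuousLinearMap.adjoint (fderiv ℝ (gradient f) w)
  have hA : ‖A (a - b)‖ ≤ L * ‖a - b‖ := norm_adjoint_fderiv_gradient_apply_le hL hLip u _
  have hAB : ‖(A - B) b‖ ≤ ρ * ‖u - w‖ * ‖b‖ := by
    refine (ContinuousLinearMap.le_opNorm _ _).trans ?_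
    gcongr
    rw [← map_sub, LinearIsometryEquiv.norm_map]
    exact hHess u w
  have hρ : 0 ≤ ρ * ‖u - w‖ := (norm_nonneg _).trans (hHess u w)
  have key : adaptedGrad f α u - adaptedGrad f α w = (a - b) - α • A (a - b) - α • (A - B) b := by
    simp only [adaptedGrad, ← ha, ← hb, map_sub, sub_apply, smul_sub, A, B]
    abel
  rw [key]
  calc _ ≤ ‖a - b‖ + ‖α • A (a - b)‖ + ‖α • (A - B) b‖ :=
        (norm_sub_le _ _).trans (by gcongr; exact norm_sub_le _ _)
    _ ≤ ‖a - b‖ + α * (L * ‖a - b‖) + α * (ρ * ‖u - w‖ * ((1 + α * L) * ‖gradient f w‖)) := by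
        rw [norm_smul, norm_smul, Real.norm_of_nonneg hα]
        gcongr
        exact hAB.trans (by gcongr)
    _ = (1 + α * L) * ‖a - b‖ + α * (ρ * ‖u - w‖ * ((1 + α * L) * ‖gradient f w‖)) := by ring
    _ ≤ (1 + α * L) * ((1 + α * L) * L * ‖u - w‖) +
        α * (ρ * ‖u - w‖ * ((1 + α * L) * ‖gradient f w‖)) := by gcongr
    _ = _ := by ring

end Calculus

end FOMAML

namespace FOMAML

/-! ### Bias, variance and averages of i.i.d. vectors -/

section SecondMoments

variable {X E : Type*} [MeasurableSpace X] [NormedAddCommGroup E] [InnerProductSpace ℝ E]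
  [CompleteSpace E] {Q : Measure X} [IsProbabilityMeasure Q] {φ : X → E}

theorem integral_norm_sub_sq_eq (hφ : MemLp φ 2 Q) (c : E) :
    ∫ x, ‖φ x - c‖ ^ 2 ∂Q =
      ∫ x, ‖φ x - ∫ y, φ y ∂Q‖ ^ 2 ∂Q + ‖(∫ y, φ y ∂Q) - c‖ ^ 2 := by
  set m := ∫ y, φ y ∂Q with hm
  have hφ1 : Integrable φ Q := hφ.integrable (by norm_num)
  have h1 : Integrable (fun x => ‖φ x - m‖ ^ 2) Q :=
    (hφ.sub (memLp_const m)).integrable_norm_pow (by norm_num)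
  have h2 : Integrable (fun x => inner ℝ (m - c) (φ x - m)) Q :=
    (hφ1.sub (integrable_const m)).const_inner (m - c)
  have h3 : ∫ x, inner ℝ (m - c) (φ x - m) ∂Q = 0 := by
    have h := integral_inner (𝕜 := ℝ) (hφ1.sub (integrable_const m)) (m - c)
    simp only [Pi.sub_apply] at h
    rw [h, integral_sub hφ1 (integrable_const m), ← hm]
    simp
  have key : ∀ x, ‖φ x - c‖ ^ 2 =
      ‖φ x - m‖ ^ 2 + (2 * inner ℝ (m - c) (φ x - m) + ‖m - c‖ ^ 2) := by
    intro x
    rw [← sub_add_sub_cancel (φ x) m c, norm_add_sq_real, real_inner_comm]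
    ring
  have h4 : Integrable (fun x => 2 * inner ℝ (m - c) (φ x - m) + ‖m - c‖ ^ 2) Q :=
    (h2.const_mul 2).add (integrable_const _)
  simp_rw [key]
  rw [integral_add h1 h4, integral_add (h2.const_mul 2) (integrable_const _),
    integral_const_mul, h3]
  simp

theorem integral_norm_sub_integral_sq_le (hφ : MemLp φ 2 Q) (c : E) :
    ∫ x, ‖φ x - ∫ y, φ y ∂Q‖ ^ 2 ∂Q ≤ ∫ x, ‖φ x - c‖ ^ 2 ∂Q := by
  rw [integral_norm_sub_sq_eq hφ c]
  nlinarith [sq_nonneg ‖(∫ y, φ y ∂Q) - c‖]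

theorem integral_norm_sq_eq (hφ : MemLp φ 2 Q) :
    ∫ x, ‖φ x‖ ^ 2 ∂Q =
      ∫ x, ‖φ x - ∫ y, φ y ∂Q‖ ^ 2 ∂Q + ‖∫ y, φ y ∂Q‖ ^ 2 := by
  simpa using integral_norm_sub_sq_eq hφ 0

/-- The variance of `‖φ‖` is nonnegative. -/
theorem integral_norm_le_of_integral_norm_sq_le (hφ : MemLp φ 2 Q) {s : ℝ} (hs : 0 ≤ s)
    (h : ∫ x, ‖φ x‖ ^ 2 ∂Q ≤ s ^ 2) : ∫ x, ‖φ x‖ ∂Q ≤ s := by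
  have h1 := integral_norm_sq_eq hφ.norm
  simp only [norm_norm] at h1
  have h2 : 0 ≤ ∫ x, ‖‖φ x‖ - ∫ y, ‖φ y‖ ∂Q‖ ^ 2 ∂Q := integral_nonneg fun x => by positivity
  rw [Real.norm_eq_abs, sq_abs] at h1
  exact abs_le_of_sq_le_sq' (by linarith) hs |>.2

theorem _root_.MeasureTheory.MemLp.integrable_inner {φ ψ : X → E} (hφ : MemLp φ 2 Q)
    (hψ : MemLp ψ 2 Q) : Integrable (fun x => inner ℝ (φ x) (ψ x)) Q := by
  refine (hφ.norm.integrable_mul hψ.norm).mono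
    (hφ.aestronglyMeasurable.inner hψ.aestronglyMeasurable)
    (Filter.Eventually.of_forall fun x => ?_)
  simpa using norm_inner_le_norm (𝕜 := ℝ) (φ x) (ψ x)

section Average

variable {n : ℕ}

theorem memLp_average (hφ : MemLp φ 2 Q) :
    MemLp (fun x : Fin n → X => (n : ℝ)⁻¹ • ∑ j, φ (x j)) 2 (Measure.pi fun _ : Fin n => Q) := by
  refine MemLp.const_smul ?_ _
  exact memLp_finsetSum _ fun j _ =>
    hφ.comp_measurePreserving (measurePreserving_eval (fun _ : Fin n => Q) j)

theorem integral_average (hn : 0 < n) (hφ : Integrable φ Q) :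
    ∫ x : Fin n → X, (n : ℝ)⁻¹ • ∑ j, φ (x j) ∂(Measure.pi fun _ : Fin n => Q) =
      ∫ x, φ x ∂Q := by
  rw [integral_smul, integral_finsetSum _ fun j _ =>
    integrable_comp_eval (μ := fun _ : Fin n => Q) (i := j) hφ]
  simp_rw [fun j => integral_comp_eval (μ := fun _ : Fin n => Q) (i := j) hφ.aestronglyMeasurable]
  rw [Finset.sum_const, Finset.card_univ, Fintype.card_fin, ← Nat.cast_smul_eq_nsmul ℝ, smul_smul,
    inv_mul_cancel₀ (by positivity), one_smul]

/-- The square expands into inner products of the centred terms; by independence those with distinct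
indices integrate to zero, and `n` equal diagonal terms remain against the factor `1 / n²`. -/
theorem integral_norm_average_sub_sq (hn : 0 < n) (hφ : MemLp φ 2 Q) :
    ∫ x : Fin n → X, ‖(n : ℝ)⁻¹ • ∑ j, φ (x j) - ∫ y, φ y ∂Q‖ ^ 2
        ∂(Measure.pi fun _ : Fin n => Q) =
      (∫ x, ‖φ x - ∫ y, φ y ∂Q‖ ^ 2 ∂Q) / n := by
  borelize E
  set m := ∫ y, φ y ∂Q with hm
  set ψ : X → E := fun x => φ x - m with hψ
  have hn0 : (n : ℝ) ≠ 0 := by positivity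
  have hφ1 : Integrable φ Q := hφ.integrable (by norm_num)
  have hψ2 : MemLp ψ 2 Q := hφ.sub (memLp_const m)
  have hψ1 : Integrable ψ Q := hψ2.integrable (by norm_num)
  have hψ0 : ∫ x, ψ x ∂Q = 0 := by
    rw [hψ, integral_sub hφ1 (integrable_const m), ← hm]; simp
  have hev : ∀ j : Fin n, MemLp (fun x : Fin n → X => ψ (x j)) 2 (Measure.pi fun _ => Q) :=
    fun j => hψ2.comp_measurePreserving (measurePreserving_eval (fun _ : Fin n => Q) j)
  have hind : iIndepFun (fun (j : Fin n) (x : Fin n → X) => ψ (x j))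
      (Measure.pi fun _ : Fin n => Q) :=
    iIndepFun_pi (X := fun _ => ψ) fun _ => hψ1.aestronglyMeasurable.aemeasurable
  have hinner : ∀ j k : Fin n,
      Integrable (fun x : Fin n → X => inner ℝ (ψ (x j)) (ψ (x k))) (Measure.pi fun _ => Q) :=
    fun j k => (hev j).integrable_inner (hev k)
  have hcross : ∀ j k : Fin n,
      ∫ x : Fin n → X, inner ℝ (ψ (x j)) (ψ (x k)) ∂(Measure.pi fun _ => Q) =
        if j = k then ∫ x, ‖ψ x‖ ^ 2 ∂Q else 0 := by
    intro j k
    split_ifs with hjk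
    · subst hjk
      simp_rw [real_inner_self_eq_norm_sq]
      exact integral_comp_eval (μ := fun _ : Fin n => Q) (i := j) (f := fun x => ‖ψ x‖ ^ 2)
        (hψ2.integrable_norm_pow (by norm_num)).aestronglyMeasurable
    · have h := (hind.indepFun hjk).integral_bilin ((hev j).integrable (by norm_num))
        ((hev k).integrable (by norm_num)) (innerSL ℝ)
      change ∫ x : Fin n → X, inner ℝ (ψ (x j)) (ψ (x k)) ∂_ = inner ℝ _ _ at h
      rw [h, integral_comp_eval (μ := fun _ : Fin n => Q) (i := j) hψ1.aestronglyMeasurable, hψ0,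
        inner_zero_left]
  have key : ∀ x : Fin n → X, ‖(n : ℝ)⁻¹ • ∑ j, φ (x j) - m‖ ^ 2 =
      ((n : ℝ)⁻¹) ^ 2 * ∑ j, ∑ k, inner ℝ (ψ (x j)) (ψ (x k)) := by
    intro x
    have h1 : (n : ℝ)⁻¹ • ∑ j, φ (x j) - m = (n : ℝ)⁻¹ • ∑ j, ψ (x j) := by
      simp only [hψ, Finset.sum_sub_distrib, Finset.sum_const, Finset.card_univ, Fintype.card_fin,
        smul_sub]
      rw [← Nat.cast_smul_eq_nsmul ℝ, smul_smul, inv_mul_cancel₀ hn0, one_smul]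
    rw [h1, norm_smul, mul_pow, Real.norm_eq_abs, sq_abs, ← real_inner_self_eq_norm_sq, sum_inner]
    simp_rw [inner_sum]
  simp_rw [key]
  rw [integral_const_mul, integral_finsetSum _ fun j _ => integrable_finsetSum _ fun k _ =>
    hinner j k]
  simp_rw [fun j => integral_finsetSum (μ := Measure.pi fun _ : Fin n => Q) Finset.univ
    fun k _ => hinner j k, hcross]
  simp only [Finset.sum_ite_eq, Finset.mem_univ, if_true, Finset.sum_const, Finset.card_univ,
    Fintype.card_fin, nsmul_eq_mul]
  field_simp
  simp [hψ]

end Average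

/-- The second-moment bounds of the assumptions, given as lower integrals, as Bochner integrals. -/
theorem memLp_two_and_integral_norm_sq_le (hφ : AEStronglyMeasurable φ Q) {s : ℝ}
    (h : ∫⁻ x, ‖φ x‖ₑ ^ 2 ∂Q ≤ ENNReal.ofReal (s ^ 2)) :
    MemLp φ 2 Q ∧ ∫ x, ‖φ x‖ ^ 2 ∂Q ≤ s ^ 2 := by
  have h2 : MemLp φ 2 Q := by
    refine ⟨hφ, ?_⟩
    rw [eLpNorm_lt_top_iff_lintegral_rpow_enorm_lt_top (by norm_num) (by norm_num)]
    simp only [ENNReal.toReal_ofNat, ENNReal.rpow_ofNat]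
    exact h.trans_lt ENNReal.ofReal_lt_top
  refine ⟨h2, ?_⟩
  rw [integral_eq_lintegral_of_nonneg_ae (Filter.Eventually.of_forall fun x => by positivity)
    (h2.integrable_norm_pow (by norm_num)).aestronglyMeasurable]
  refine ENNReal.toReal_le_of_le_ofReal (sq_nonneg s) (le_of_eq_of_le ?_ h)
  refine lintegral_congr fun x => ?_
  rw [ENNReal.ofReal_pow (norm_nonneg _), ofReal_norm]

end SecondMoments

end FOMAML

namespace FOMAML

namespace Assumptions

/-! ### Measurability and moments of the task gradients -/

section Gradients

variable {d : ℕ} {I Θ : Type*} [MeasurableSpace I] [MeasurableSpace Θ] {p : Measure I}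
  {P : Kernel I Θ} [IsMarkovKernel P] {f : I → Param d → ℝ} {g : I → Param d → Θ → Param d}
  {α L ρ σ σt : ℝ}

theorem continuous_gradient (hA : Assumptions p f P g α L ρ σ σt) (i : I) :
    Continuous (gradient (f i)) :=
  (contDiff_gradient (hA.contDiff i)).continuous

/-- A Carathéodory function: continuous in the point, and measurable in the task because
unbiasedness writes it as the integral of the stochastic gradient against the kernel `P`. -/
theorem measurable_gradient (hA : Assumptions p f P g α L ρ σ σt) :
    Measurable fun x : Param d × I => gradient (f x.2) x.1 := by
  refine measurable_uncurry_of_continuous_of_measurable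
    (u := fun (w : Param d) (i : I) => gradient (f i) w) (fun i => hA.continuous_gradient i)
    fun w => ?_
  have h : (fun i => gradient (f i) w) = fun i => ∫ θ, g i w θ ∂(P i) := by
    ext1 i; exact (hA.unbiased i w).symm
  rw [h]
  have h2 : Measurable fun y : I × Θ => g y.1 w y.2 :=
    hA.measurable_sgrad.comp (measurable_fst.prodMk (measurable_const.prodMk measurable_snd))
  exact (h2.stronglyMeasurable.integral_kernel_prod_right (κ := P)
    (f := fun i θ => g i w θ)).measurable

theorem measurable_gradient_comp (hA : Assumptions p f P g α L ρ σ σt) {X : Type*}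
    [MeasurableSpace X] {i : X → I} {w : X → Param d} (hi : Measurable i) (hw : Measurable w) :
    Measurable fun x => gradient (f (i x)) (w x) :=
  hA.measurable_gradient.comp (hw.prodMk hi)

theorem measurable_adaptedLoss (hA : Assumptions p f P g α L ρ σ σt) (w : Param d) :
    Measurable fun i => adaptedLoss f α i w := by
  have h : Measurable fun x : Param d × I => f x.2 x.1 :=
    measurable_uncurry_of_continuous_of_measurable
      (u := fun (w : Param d) (i : I) => f i w) (fun i => (hA.contDiff i).continuous)
      fun w => hA.measurable_loss w
  exact h.comp ((measurable_const.sub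
    ((hA.measurable_gradient_comp measurable_id measurable_const).const_smul α)).prodMk
      measurable_id)

theorem hasGradientAt_adaptedLoss (hA : Assumptions p f P g α L ρ σ σt) (i : I) (w : Param d) :
    HasGradientAt (adaptedLoss f α i) (adaptedGrad (f i) α w) w :=
  hasGradientAt_comp_gradientStep (hA.contDiff i) α w

/-- The Hessian in the definition is avoided: each directional component is a limit of difference
quotients of the adapted loss, with increments `1/n`. -/
theorem measurable_adaptedGrad (hA : Assumptions p f P g α L ρ σ σt) (w : Param d) :
    Measurable fun i => adaptedGrad (f i) α w := by
  have hv : ∀ v : Param d, Measurable fun i => inner ℝ (adaptedGrad (f i) α w) v := by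
    intro v
    refine measurable_of_tendsto_metrizable (f := fun (n : ℕ) i =>
      (n : ℝ) • (adaptedLoss f α i (w + (n : ℝ)⁻¹ • v) - adaptedLoss f α i w))
      (fun n => ?_) ?_
    · have h1 := hA.measurable_adaptedLoss (w + (n : ℝ)⁻¹ • v)
      have h2 := hA.measurable_adaptedLoss w
      fun_prop
    rw [tendsto_pi_nhds]
    intro i
    have h := (hA.hasGradientAt_adaptedLoss i w).hasFDerivAt.lim_real v
    rw [InnerProductSpace.toDual_apply_apply] at h
    exact h.comp tendsto_natCast_atTop_atTop
  have h2 : Measurable fun i => (WithLp.ofLp (adaptedGrad (f i) α w)) := by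
    refine measurable_pi_lambda _ fun j => ?_
    have h := hv (EuclideanSpace.single j 1)
    simpa [EuclideanSpace.inner_single_right] using h
  exact (WithLp.measurable_toLp 2 (Fin d → ℝ)).comp h2

theorem memLp_gradient_sub [IsProbabilityMeasure p] (hA : Assumptions p f P g α L ρ σ σt)
    (w : Param d) :
    MemLp (fun i => gradient (f i) w - ∫ j, gradient (f j) w ∂p) 2 p ∧
      ∫ i, ‖gradient (f i) w - ∫ j, gradient (f j) w ∂p‖ ^ 2 ∂p ≤ σ ^ 2 := by
  refine memLp_two_and_integral_norm_sq_le
    ((hA.measurable_gradient_comp measurable_id measurable_const).sub_const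
      _).aestronglyMeasurable ?_
  refine le_of_eq_of_le (lintegral_congr fun i => ?_) (hA.task_variance w)
  rw [enorm_sub_rev]
  rfl

theorem memLp_gradient [IsProbabilityMeasure p] (hA : Assumptions p f P g α L ρ σ σt)
    (w : Param d) : MemLp (fun i => gradient (f i) w) 2 p := by
  refine ((hA.memLp_gradient_sub w).1.add (memLp_const (∫ j, gradient (f j) w ∂p))).congr_norm
    (hA.measurable_gradient_comp measurable_id measurable_const).aestronglyMeasurable
    (Filter.Eventually.of_forall fun i => ?_)
  simp

theorem integral_norm_gradient_le [IsProbabilityMeasure p] (hA : Assumptions p f P g α L ρ σ σt)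
    (hσ : 0 ≤ σ) (w : Param d) :
    ∫ i, ‖gradient (f i) w‖ ∂p ≤ ‖∫ i, gradient (f i) w ∂p‖ + σ := by
  have h1 := integral_norm_le_of_integral_norm_sq_le (hA.memLp_gradient_sub w).1 hσ
    (hA.memLp_gradient_sub w).2
  have h2 : ∫ i, ‖gradient (f i) w‖ ∂p ≤
      ∫ i, (‖∫ i, gradient (f i) w ∂p‖ + ‖gradient (f i) w - ∫ j, gradient (f j) w ∂p‖) ∂p := by
    refine integral_mono (hA.integrable_grad w).norm ((integrable_const _).add
      ((hA.memLp_gradient_sub w).1.integrable (by norm_num)).norm) fun i => ?_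
    exact norm_le_norm_add_norm_sub' _ _
  rw [integral_add (integrable_const _)
    ((hA.memLp_gradient_sub w).1.integrable (by norm_num)).norm] at h2
  simp only [integral_const, probReal_univ, one_smul] at h2
  linarith

theorem integral_norm_gradient_sq_le [IsProbabilityMeasure p]
    (hA : Assumptions p f P g α L ρ σ σt) (w : Param d) :
    ∫ i, ‖gradient (f i) w‖ ^ 2 ∂p ≤ ‖∫ i, gradient (f i) w ∂p‖ ^ 2 + σ ^ 2 := by
  rw [integral_norm_sq_eq (hA.memLp_gradient w)]
  linarith [(hA.memLp_gradient_sub w).2]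

end Gradients

/-! ### Differentiability and local smoothness of the meta-objective -/

section MetaObjective

variable {d : ℕ} {I Θ : Type*} [MeasurableSpace I] [MeasurableSpace Θ] {p : Measure I}
  [IsProbabilityMeasure p]
  {P : Kernel I Θ} [IsMarkovKernel P] {f : I → Param d → ℝ} {g : I → Param d → Θ → Param d}
  {α L ρ σ σt : ℝ}

/-- The Taylor estimate bounds the adapted loss by the loss at `w` and the squared gradient, which
is integrable by the variance assumption. -/
theorem integrable_adaptedLoss (hA : Assumptions p f P g α L ρ σ σt) (hL : 0 ≤ L) (w : Param d) :
    Integrable (fun i => adaptedLoss f α i w) p := by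
  have h2 := (hA.memLp_gradient w).integrable_norm_pow (by norm_num)
  have h3 : Integrable (fun i => |f i w| + (|α| + L * α ^ 2) * ‖gradient (f i) w‖ ^ 2) p :=
    (hA.integrable_loss w).abs.add (h2.const_mul _)
  refine h3.mono' (hA.measurable_adaptedLoss w).aestronglyMeasurable
    (Filter.Eventually.of_forall fun i => ?_)
  have h := abs_sub_sub_inner_le (F := f i) (G := gradient (f i))
    (fun u => ((hA.contDiff i).differentiable (by norm_num) u).hasGradientAt) hL
    (w := w) (fun u => hA.grad_lipschitz i u w) (w - α • gradient (f i) w)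
  rw [sub_sub_cancel_left, norm_neg, inner_neg_right, inner_smul_right,
    real_inner_self_eq_norm_sq, norm_smul, mul_pow, Real.norm_eq_abs, sq_abs] at h
  change |f i (w - α • gradient (f i) w)| ≤ _
  set a := f i (w - α • gradient (f i) w)
  set N := ‖gradient (f i) w‖ ^ 2
  have hN : 0 ≤ N := by positivity
  have e1 : |a| ≤ |a - f i w - -(α * N)| + |f i w| + |α * N| := by
    have : a = (a - f i w - -(α * N)) + f i w + -(α * N) := by ring
    calc |a| = |(a - f i w - -(α * N)) + f i w + -(α * N)| := by rw [← this]
      _ ≤ _ := (abs_add_three _ _ _).trans_eq (by rw [abs_neg])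
  rw [abs_mul, abs_of_nonneg hN] at e1
  linarith

theorem integrable_adaptedGrad (hA : Assumptions p f P g α L ρ σ σt) (hα : 0 ≤ α) (hL : 0 ≤ L)
    (w : Param d) : Integrable (fun i => adaptedGrad (f i) α w) p :=
  ((hA.integrable_grad w).norm.const_mul ((1 + α * L) ^ 2)).mono'
    (hA.measurable_adaptedGrad w).aestronglyMeasurable
    (Filter.Eventually.of_forall fun i => norm_adaptedGrad_le hα hL (hA.grad_lipschitz i) w)

/-- Differentiation under the integral: on the unit ball around `w`, the Lipschitz bound dominates
the task gradients by `‖∇f_i(w)‖ + L`. -/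
theorem hasGradientAt_metaObjective (hA : Assumptions p f P g α L ρ σ σt) (hα : 0 ≤ α)
    (hL : 0 ≤ L) (w : Param d) :
    HasGradientAt (metaObjective p f α) (∫ i, adaptedGrad (f i) α w ∂p) w := by
  rw [hasGradientAt_iff_hasFDerivAt]
  have h := hasFDerivAt_integral_of_dominated_of_fderiv_le (𝕜 := ℝ) (μ := p)
    (F := fun w i => adaptedLoss f α i w) (x₀ := w) (s := Metric.ball w 1)
    (F' := fun w i => InnerProductSpace.toDual ℝ (Param d) (adaptedGrad (f i) α w))
    (bound := fun i => (1 + α * L) ^ 2 * (‖gradient (f i) w‖ + L))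
    (Metric.ball_mem_nhds w one_pos)
    (Filter.Eventually.of_forall fun w => (hA.measurable_adaptedLoss w).aestronglyMeasurable)
    (hA.integrable_adaptedLoss hL w)
    ((InnerProductSpace.toDual ℝ (Param d)).continuous.comp_aestronglyMeasurable
      (hA.measurable_adaptedGrad w).aestronglyMeasurable)
    (Filter.Eventually.of_forall fun i u hu => by
      rw [LinearIsometryEquiv.norm_map]
      refine (norm_adaptedGrad_le hα hL (hA.grad_lipschitz i) u).trans ?_
      gcongr
      have h1 := hA.grad_lipschitz i u w
      have h2 : ‖u - w‖ ≤ 1 := by rw [← dist_eq_norm]; exact (Metric.mem_ball.mp hu).le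
      have h3 := norm_le_norm_add_norm_sub' (gradient (f i) u) (gradient (f i) w)
      nlinarith)
    (((hA.integrable_grad w).norm.add (integrable_const L)).const_mul _)
    (Filter.Eventually.of_forall fun i u _ => (hA.hasGradientAt_adaptedLoss i u).hasFDerivAt)
  refine h.congr_fderiv ?_
  exact (ContinuousLinearMap.integral_comp_comm
    (InnerProductSpace.toDual ℝ (Param d)).toContinuousLinearEquiv.toContinuousLinearMap
    (hA.integrable_adaptedGrad hα hL w))

theorem gradient_metaObjective (hA : Assumptions p f P g α L ρ σ σt) (hα : 0 ≤ α) (hL : 0 ≤ L)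
    (w : Param d) :
    gradient (metaObjective p f α) w = ∫ i, adaptedGrad (f i) α w ∂p :=
  (hA.hasGradientAt_metaObjective hα hL w).gradient

theorem differentiable_metaObjective (hA : Assumptions p f P g α L ρ σ σt) (hα : 0 ≤ α)
    (hL : 0 ≤ L) : Differentiable ℝ (metaObjective p f α) :=
  fun w => (hA.hasGradientAt_metaObjective hα hL w).differentiableAt

theorem norm_gradient_metaObjective_sub_le (hA : Assumptions p f P g α L ρ σ σt) (hα : 0 ≤ α)
    (hL : 0 ≤ L) (w u : Param d) :
    ‖gradient (metaObjective p f α) u - gradient (metaObjective p f α) w‖ ≤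
      ((1 + α * L) ^ 2 * L + α * ρ * (1 + α * L) * ∫ i, ‖gradient (f i) w‖ ∂p) * ‖u - w‖ := by
  have hint : Integrable (fun i => ((1 + α * L) ^ 2 * L +
      α * ρ * (1 + α * L) * ‖gradient (f i) w‖) * ‖u - w‖) p :=
    ((integrable_const _).add ((hA.integrable_grad w).norm.const_mul _)).mul_const _
  rw [hA.gradient_metaObjective hα hL, hA.gradient_metaObjective hα hL,
    ← integral_sub (hA.integrable_adaptedGrad hα hL u) (hA.integrable_adaptedGrad hα hL w)]
  refine (norm_integral_le_of_norm_le hint (Filter.Eventually.of_forall fun i =>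
    norm_adaptedGrad_sub_adaptedGrad_le hα hL (hA.grad_lipschitz i)
      (hA.hessian_lipschitz i) w u)).trans_eq ?_
  rw [integral_mul_const, integral_add (integrable_const _)
    ((hA.integrable_grad w).norm.const_mul _), integral_const, probReal_univ,
    one_smul, integral_const_mul]

theorem continuous_gradient_metaObjective (hA : Assumptions p f P g α L ρ σ σt) (hα : 0 ≤ α)
    (hL : 0 ≤ L) : Continuous (gradient (metaObjective p f α)) := by
  refine continuous_iff_continuousAt.2 fun w => ?_
  rw [ContinuousAt, tendsto_iff_norm_sub_tendsto_zero]
  refine squeeze_zero (fun u => norm_nonneg _)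
    (fun u => hA.norm_gradient_metaObjective_sub_le hα hL w u) ?_
  have h : Continuous fun u : Param d =>
    ((1 + α * L) ^ 2 * L + α * ρ * (1 + α * L) * ∫ i, ‖gradient (f i) w‖ ∂p) * ‖u - w‖ := by
    fun_prop
  simpa using h.tendsto w

theorem metaObjective_le (hA : Assumptions p f P g α L ρ σ σt) (hα : 0 ≤ α) (hL : 0 ≤ L)
    (hρ : 0 ≤ ρ) (w u : Param d) :
    metaObjective p f α u ≤ metaObjective p f α w +
      inner ℝ (gradient (metaObjective p f α) w) (u - w) +
      ((1 + α * L) ^ 2 * L + α * ρ * (1 + α * L) * ∫ i, ‖gradient (f i) w‖ ∂p) *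
        ‖u - w‖ ^ 2 := by
  have hM : 0 ≤ ∫ i, ‖gradient (f i) w‖ ∂p := integral_nonneg fun i => norm_nonneg _
  have h := abs_sub_sub_inner_le (F := metaObjective p f α)
    (fun u => (hA.differentiable_metaObjective hα hL u).hasGradientAt)
    (by positivity) (fun u => hA.norm_gradient_metaObjective_sub_le hα hL w u) u
  linarith [(abs_le.1 h).2]

/-- Needed because the error terms involve the task gradients at `w`, while the progress is measured
by the meta-gradient. -/
theorem norm_integral_gradient_sub_le (hA : Assumptions p f P g α L ρ σ σt) (hα : 0 ≤ α)
    (hL : 0 ≤ L) (w : Param d) :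
    ‖∫ i, gradient (f i) w ∂p - gradient (metaObjective p f α) w‖ ≤
      α * L * (2 + α * L) * ∫ i, ‖gradient (f i) w‖ ∂p := by
  rw [hA.gradient_metaObjective hα hL,
    ← integral_sub (hA.integrable_grad w) (hA.integrable_adaptedGrad hα hL w),
    ← integral_const_mul]
  refine norm_integral_le_of_norm_le ((hA.integrable_grad w).norm.const_mul _)
    (Filter.Eventually.of_forall fun i => ?_)
  have h1 := norm_adaptedGrad_sub_le hα hL (hA.grad_lipschitz i) w
  have h2 := norm_gradient_sub_smul_le hα (hA.grad_lipschitz i) w (gradient (f i) w)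
  have h3 := norm_sub_le_norm_sub_add_norm_sub (adaptedGrad (f i) α w)
    (gradient (f i) (w - α • gradient (f i) w)) (gradient (f i) w)
  rw [norm_sub_rev]
  linarith

end MetaObjective

/-! ### Stochastic gradients of one task on a dataset -/

section Dataset

variable {d : ℕ} {I Θ : Type*} [MeasurableSpace I] [MeasurableSpace Θ] {p : Measure I}
  {P : Kernel I Θ} [IsMarkovKernel P] {f : I → Param d → ℝ} {g : I → Param d → Θ → Param d}
  {α L ρ σ σt : ℝ}

theorem memLp_sgrad_sub (hA : Assumptions p f P g α L ρ σ σt) (i : I) (w : Param d) :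
    MemLp (fun θ => g i w θ - gradient (f i) w) 2 (P i) ∧
      ∫ θ, ‖g i w θ - gradient (f i) w‖ ^ 2 ∂(P i) ≤ σt ^ 2 := by
  refine memLp_two_and_integral_norm_sq_le ?_ (hA.data_variance i w)
  exact ((hA.measurable_sgrad.comp (measurable_const.prodMk
    (measurable_const.prodMk measurable_id))).sub_const _).aestronglyMeasurable

theorem memLp_sgrad (hA : Assumptions p f P g α L ρ σ σt) (i : I) (w : Param d) :
    MemLp (g i w) 2 (P i) := by
  refine ((hA.memLp_sgrad_sub i w).1.add (memLp_const (gradient (f i) w))).congr_norm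
    (hA.measurable_sgrad.comp (measurable_const.prodMk
      (measurable_const.prodMk measurable_id))).aestronglyMeasurable
    (Filter.Eventually.of_forall fun i => ?_)
  simp

variable {n : ℕ}

theorem memLp_batchGrad (hA : Assumptions p f P g α L ρ σ σt) (i : I) (w : Param d) :
    MemLp (batchGrad g i w) 2 (Measure.pi fun _ : Fin n => P i) :=
  memLp_average (hA.memLp_sgrad i w)

theorem integral_batchGrad (hA : Assumptions p f P g α L ρ σ σt) (hn : 0 < n) (i : I)
    (w : Param d) :
    ∫ D, batchGrad g i w D ∂(Measure.pi fun _ : Fin n => P i) = gradient (f i) w :=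
  (integral_average hn ((hA.memLp_sgrad i w).integrable (by norm_num))).trans (hA.unbiased i w)

theorem integral_norm_batchGrad_sub_sq_le (hA : Assumptions p f P g α L ρ σ σt) (hn : 0 < n)
    (i : I) (w : Param d) :
    ∫ D, ‖batchGrad g i w D - gradient (f i) w‖ ^ 2 ∂(Measure.pi fun _ : Fin n => P i) ≤
      σt ^ 2 / n := by
  have h := integral_norm_average_sub_sq hn (hA.memLp_sgrad i w)
  rw [hA.unbiased i w] at h
  refine h.trans_le ?_
  gcongr
  exact (hA.memLp_sgrad_sub i w).2

theorem measurable_batchGrad (hA : Assumptions p f P g α L ρ σ σt) :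
    Measurable fun x : I × Param d × (Fin n → Θ) => batchGrad g x.1 x.2.1 x.2.2 := by
  have h : ∀ j, Measurable fun x : I × Param d × (Fin n → Θ) => g x.1 x.2.1 (x.2.2 j) :=
    fun j => hA.measurable_sgrad.comp (measurable_fst.prodMk (measurable_snd.fst.prodMk
    ((measurable_pi_apply j).comp measurable_snd.snd)))
  have h2 : Measurable fun x : I × Param d × (Fin n → Θ) => ∑ j, g x.1 x.2.1 (x.2.2 j) :=
    Finset.measurable_fun_sum _ fun j _ => h j
  exact h2.const_smul ((n : ℝ)⁻¹)

theorem measurable_batchGrad_comp (hA : Assumptions p f P g α L ρ σ σt) {X : Type*}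
    [MeasurableSpace X] {i : X → I} {w : X → Param d} {D : X → Fin n → Θ} (hi : Measurable i)
    (hw : Measurable w) (hD : Measurable D) :
    Measurable fun x => batchGrad g (i x) (w x) (D x) :=
  hA.measurable_batchGrad.comp (hi.prodMk (hw.prodMk hD))

end Dataset

end Assumptions

end FOMAML

/-! ### Laws of the draws and noise of the datasets -/

namespace FOMAML

theorem memLp_two_and_integral_norm_sq_le' {X E : Type*} [MeasurableSpace X]
    [NormedAddCommGroup E] [InnerProductSpace ℝ E]
    [CompleteSpace E] {Q : Measure X} [IsProbabilityMeasure Q] {φ : X → E}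
    (hφ : AEStronglyMeasurable φ Q) {v : ℝ} (hv : 0 ≤ v)
    (h : ∫⁻ x, ‖φ x‖ₑ ^ 2 ∂Q ≤ ENNReal.ofReal v) :
    MemLp φ 2 Q ∧ ∫ x, ‖φ x‖ ^ 2 ∂Q ≤ v := by
  have := memLp_two_and_integral_norm_sq_le (s := √v) hφ (by rwa [Real.sq_sqrt hv])
  rwa [Real.sq_sqrt hv] at this

theorem lintegral_enorm_sq_le {X E : Type*} [MeasurableSpace X] [NormedAddCommGroup E]
    {Q : Measure X} {φ : X → E} (hφ : MemLp φ 2 Q) {v : ℝ} (h : ∫ x, ‖φ x‖ ^ 2 ∂Q ≤ v) :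
    ∫⁻ x, ‖φ x‖ₑ ^ 2 ∂Q ≤ ENNReal.ofReal v := by
  refine le_of_eq_of_le ?_ (ENNReal.ofReal_le_ofReal h)
  rw [ofReal_integral_eq_lintegral_ofReal (hφ.integrable_norm_pow (by norm_num))
    (Filter.Eventually.of_forall fun x => by positivity)]
  refine lintegral_congr fun x => ?_
  rw [ENNReal.ofReal_pow (norm_nonneg _), ofReal_norm]

theorem integral_comp_measurePreserving {X Y E : Type*} [MeasurableSpace X] [MeasurableSpace Y]
    [NormedAddCommGroup E] [NormedSpace ℝ E] {μ : Measure X} {ν : Measure Y} {T : X → Y}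
    (hT : MeasurePreserving T μ ν) {φ : Y → E} (hφ : AEStronglyMeasurable φ ν) :
    ∫ x, φ (T x) ∂μ = ∫ y, φ y ∂ν := by
  rw [← hT.map_eq] at hφ ⊢
  exact (integral_map hT.measurable.aemeasurable hφ).symm

section Laws

variable {I Θ : Type*} [MeasurableSpace I] [MeasurableSpace Θ] (p : Measure I)
  [IsProbabilityMeasure p] (P : Kernel I Θ) [IsMarkovKernel P]

instance isMarkovKernel_datasetKernel (n : ℕ) : IsMarkovKernel (datasetKernel P n) :=
  ⟨fun i => inferInstanceAs (IsProbabilityMeasure (Measure.pi fun _ : Fin n => P i))⟩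

instance isProbabilityMeasure_stepsizeDrawLaw (n : ℕ) :
    IsProbabilityMeasure (stepsizeDrawLaw p P n) := by
  unfold stepsizeDrawLaw; infer_instance

instance isProbabilityMeasure_metaDrawLaw (n m : ℕ) :
    IsProbabilityMeasure (metaDrawLaw p P n m) := by
  unfold metaDrawLaw; infer_instance

instance isProbabilityMeasure_iterDrawLaw (B Din Dout B' Dβ : ℕ) :
    IsProbabilityMeasure (iterDrawLaw p P B Din Dout B' Dβ) := by
  unfold iterDrawLaw; infer_instance

theorem measurePreserving_fst_stepsizeDrawLaw (n : ℕ) :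
    MeasurePreserving Prod.fst (stepsizeDrawLaw p P n) p :=
  ⟨measurable_fst, Measure.fst_compProd _ _⟩

/-- Forgetting the outer dataset turns a meta draw into a stepsize draw, so the estimates for one
dataset also apply to the inner step. -/
theorem measurePreserving_metaDrawLaw (n m : ℕ) :
    MeasurePreserving (fun s : MetaDraw I Θ n m => (s.1, s.2.1)) (metaDrawLaw p P n m)
      (stepsizeDrawLaw p P n) := by
  refine ⟨by fun_prop, ?_⟩
  have h := Measure.compProd_map (μ := p) (κ := datasetKernel P n ×ₖ datasetKernel P m)
    (f := Prod.fst) measurable_fst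
  have h2 : (datasetKernel P n ×ₖ datasetKernel P m).map Prod.fst = datasetKernel P n := by
    rw [← Kernel.fst_eq, Kernel.fst_prod]
  rw [h2] at h
  exact h.symm

theorem lintegral_metaDrawLaw {n m : ℕ} {φ : MetaDraw I Θ n m → ENNReal} (hφ : Measurable φ) :
    ∫⁻ s, φ s ∂(metaDrawLaw p P n m) =
      ∫⁻ i, ∫⁻ a, ∫⁻ b, φ (i, (a, b)) ∂(Measure.pi fun _ : Fin m => P i)
        ∂(Measure.pi fun _ : Fin n => P i) ∂p := by
  rw [metaDrawLaw, Measure.lintegral_compProd hφ]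
  refine lintegral_congr fun i => ?_
  rw [Kernel.prod_apply]
  exact lintegral_prod _ (hφ.comp (by fun_prop : Measurable fun x => (i, x))).aemeasurable

/-- If a variable has mean zero with respect to the outer dataset, then it has mean zero. -/
theorem integral_metaDrawLaw_eq_zero {n m : ℕ} {E : Type*} [NormedAddCommGroup E]
    [NormedSpace ℝ E] {φ : MetaDraw I Θ n m → E} (hφ : Integrable φ (metaDrawLaw p P n m))
    (h : ∀ i a, ∫ b, φ (i, (a, b)) ∂(Measure.pi fun _ : Fin m => P i) = 0) :
    ∫ s, φ s ∂(metaDrawLaw p P n m) = 0 := by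
  rw [metaDrawLaw, Measure.integral_compProd hφ]
  refine integral_eq_zero_of_ae (Filter.Eventually.of_forall fun i => ?_)
  -- Integrability of the section is not needed: where it fails, the Bochner integral is zero by
  -- convention.
  by_cases hi : Integrable (fun x => φ (i, x)) ((datasetKernel P n ×ₖ datasetKernel P m) i)
  · change ∫ x, φ (i, x) ∂((datasetKernel P n ×ₖ datasetKernel P m) i) = 0
    rw [Kernel.prod_apply] at hi ⊢
    simp only [integral_prod _ hi]
    exact integral_eq_zero_of_ae (Filter.Eventually.of_forall fun a => h i a)
  · exact integral_undef hi

end Laws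

namespace Assumptions

variable {d : ℕ} {I Θ : Type*} [MeasurableSpace I] [MeasurableSpace Θ] {p : Measure I}
  [IsProbabilityMeasure p]
  {P : Kernel I Θ} [IsMarkovKernel P] {f : I → Param d → ℝ} {g : I → Param d → Θ → Param d}
  {α L ρ σ σt : ℝ}

theorem memLp_batchGrad_sub_stepsizeDraw (hA : Assumptions p f P g α L ρ σ σt) {n : ℕ}
    (hn : 0 < n) (w : Param d) :
    MemLp (fun s : StepsizeDraw I Θ n => batchGrad g s.1 w s.2 - gradient (f s.1) w) 2
        (stepsizeDrawLaw p P n) ∧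
      ∫ s : StepsizeDraw I Θ n, ‖batchGrad g s.1 w s.2 - gradient (f s.1) w‖ ^ 2
        ∂(stepsizeDrawLaw p P n) ≤ σt ^ 2 / n := by
  have hm : Measurable fun s : StepsizeDraw I Θ n =>
      batchGrad g s.1 w s.2 - gradient (f s.1) w :=
    (hA.measurable_batchGrad_comp measurable_fst measurable_const measurable_snd).sub
      (hA.measurable_gradient_comp measurable_fst measurable_const)
  refine memLp_two_and_integral_norm_sq_le' hm.aestronglyMeasurable (by positivity) ?_
  rw [stepsizeDrawLaw, Measure.lintegral_compProd (hm.enorm.pow_const 2)]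
  have h : ∀ i, ∫⁻ D, ‖batchGrad g i w D - gradient (f i) w‖ₑ ^ 2 ∂(datasetKernel P n i) ≤
      ENNReal.ofReal (σt ^ 2 / n) := fun i =>
    lintegral_enorm_sq_le (Q := Measure.pi fun _ : Fin n => P i)
      ((hA.memLp_batchGrad i w).sub (memLp_const _))
      (hA.integral_norm_batchGrad_sub_sq_le hn i w)
  calc _ ≤ ∫⁻ _, ENNReal.ofReal (σt ^ 2 / n) ∂p := lintegral_mono h
    _ = _ := by rw [lintegral_const, measure_univ, mul_one]

theorem integral_norm_batchGrad_sub_stepsizeDraw_le (hA : Assumptions p f P g α L ρ σ σt)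
    (hσt : 0 ≤ σt) {n : ℕ} (hn : 0 < n) (w : Param d) :
    ∫ s : StepsizeDraw I Θ n, ‖batchGrad g s.1 w s.2 - gradient (f s.1) w‖
        ∂(stepsizeDrawLaw p P n) ≤ σt / √n := by
  have h := hA.memLp_batchGrad_sub_stepsizeDraw hn w
  refine integral_norm_le_of_integral_norm_sq_le h.1 (by positivity) (h.2.trans_eq ?_)
  rw [div_pow, Real.sq_sqrt (Nat.cast_nonneg n)]

theorem memLp_gradient_stepsizeDraw (hA : Assumptions p f P g α L ρ σ σt) {n : ℕ} (w : Param d) :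
    MemLp (fun s : StepsizeDraw I Θ n => gradient (f s.1) w) 2 (stepsizeDrawLaw p P n) :=
  (hA.memLp_gradient w).comp_measurePreserving (measurePreserving_fst_stepsizeDrawLaw p P n)

theorem memLp_batchGrad_stepsizeDraw (hA : Assumptions p f P g α L ρ σ σt) {n : ℕ}
    (hn : 0 < n) (w : Param d) :
    MemLp (fun s : StepsizeDraw I Θ n => batchGrad g s.1 w s.2) 2 (stepsizeDrawLaw p P n) := by
  refine ((hA.memLp_batchGrad_sub_stepsizeDraw hn w).1.add
    (hA.memLp_gradient_stepsizeDraw w)).congr_norm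
    (hA.measurable_batchGrad_comp measurable_fst measurable_const
      measurable_snd).aestronglyMeasurable (Filter.Eventually.of_forall fun s => ?_)
  simp

theorem integral_norm_gradient_stepsizeDraw (hA : Assumptions p f P g α L ρ σ σt) {n : ℕ}
    (w : Param d) :
    ∫ s : StepsizeDraw I Θ n, ‖gradient (f s.1) w‖ ∂(stepsizeDrawLaw p P n) =
      ∫ i, ‖gradient (f i) w‖ ∂p := by
  exact integral_comp_measurePreserving (measurePreserving_fst_stepsizeDrawLaw p P n)
    (hA.integrable_grad w).norm.aestronglyMeasurable

theorem integral_norm_batchGrad_stepsizeDraw_le (hA : Assumptions p f P g α L ρ σ σt)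
    (hσt : 0 ≤ σt) {n : ℕ} (hn : 0 < n) (w : Param d) :
    ∫ s : StepsizeDraw I Θ n, ‖batchGrad g s.1 w s.2‖ ∂(stepsizeDrawLaw p P n) ≤
      ∫ i, ‖gradient (f i) w‖ ∂p + σt / √n := by
  have h1 := ((hA.memLp_batchGrad_sub_stepsizeDraw hn w).1.integrable (by norm_num)).norm
  have h2 := ((hA.memLp_gradient_stepsizeDraw (n := n) w).integrable (by norm_num)).norm
  refine (integral_mono ((hA.memLp_batchGrad_stepsizeDraw hn w).integrable (by norm_num)).norm
    (h2.add h1) fun s => norm_le_norm_add_norm_sub' _ _).trans ?_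
  simp only [Pi.add_apply]
  rw [integral_add h2 h1, hA.integral_norm_gradient_stepsizeDraw]
  linarith [hA.integral_norm_batchGrad_sub_stepsizeDraw_le hσt hn w]

/-- Jensen's inequality for the norm, conditionally on the task, together with unbiasedness. -/
theorem le_integral_norm_batchGrad_stepsizeDraw (hA : Assumptions p f P g α L ρ σ σt)
    {n : ℕ} (hn : 0 < n) (w : Param d) :
    ∫ i, ‖gradient (f i) w‖ ∂p ≤
      ∫ s : StepsizeDraw I Θ n, ‖batchGrad g s.1 w s.2‖ ∂(stepsizeDrawLaw p P n) := by
  have h1 := ((hA.memLp_batchGrad_stepsizeDraw hn w).integrable (by norm_num)).norm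
  rw [stepsizeDrawLaw] at h1 ⊢
  rw [Measure.integral_compProd h1]
  refine integral_mono (hA.integrable_grad w).norm h1.integral_compProd fun i => ?_
  refine le_of_eq_of_le ?_ (norm_integral_le_integral_norm _)
  exact congrArg norm (hA.integral_batchGrad hn i w).symm

theorem integral_norm_batchGrad_stepsizeDraw_variance_le (hA : Assumptions p f P g α L ρ σ σt)
    {n : ℕ} (hn : 0 < n) (w : Param d) :
    ∫ s : StepsizeDraw I Θ n, ‖‖batchGrad g s.1 w s.2‖ -
        ∫ s : StepsizeDraw I Θ n, ‖batchGrad g s.1 w s.2‖ ∂(stepsizeDrawLaw p P n)‖ ^ 2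
          ∂(stepsizeDrawLaw p P n) ≤ 2 * σ ^ 2 + 2 * (σt ^ 2 / n) := by
  set m := ∫ j, gradient (f j) w ∂p
  have hp := measurePreserving_fst_stepsizeDrawLaw p P n
  have h1 := (hA.memLp_batchGrad_sub_stepsizeDraw hn w).1.integrable_norm_pow (p := 2)
    (by norm_num)
  have h2 : Integrable (fun s : StepsizeDraw I Θ n => ‖gradient (f s.1) w - m‖ ^ 2)
      (stepsizeDrawLaw p P n) :=
    ((hA.memLp_gradient_sub w).1.comp_measurePreserving hp).integrable_norm_pow (by norm_num)
  have h3 : ∫ s : StepsizeDraw I Θ n, ‖gradient (f s.1) w - m‖ ^ 2 ∂(stepsizeDrawLaw p P n) ≤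
      σ ^ 2 := by
    refine le_of_eq_of_le ?_ (hA.memLp_gradient_sub w).2
    exact integral_comp_measurePreserving hp ((hA.memLp_gradient_sub w).1.integrable_norm_pow (by norm_num)).aestronglyMeasurable
  have hN := (hA.memLp_batchGrad_stepsizeDraw hn w).norm
  -- The mean minimises the quadratic deviation, so it may be replaced by `‖m‖`, from which the
  -- triangle inequality passes through the exact task gradient.
  refine (integral_norm_sub_integral_sq_le hN ‖m‖).trans ?_
  refine (integral_mono ((hN.sub (memLp_const ‖m‖)).integrable_norm_pow (by norm_num))
    ((h2.const_mul 2).add (h1.const_mul 2)) fun s => ?_).trans ?_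
  · have e1 : ‖‖batchGrad g s.1 w s.2‖ - ‖m‖‖ ≤
        ‖batchGrad g s.1 w s.2 - gradient (f s.1) w‖ + ‖gradient (f s.1) w - m‖ :=
      (abs_norm_sub_norm_le _ _).trans (norm_sub_le_norm_sub_add_norm_sub _ _ _)
    simp only [Pi.add_apply, Pi.sub_apply]
    set x := ‖batchGrad g s.1 w s.2 - gradient (f s.1) w‖
    set y := ‖gradient (f s.1) w - m‖
    calc _ ≤ (x + y) ^ 2 := by gcongr
      _ ≤ 2 * y ^ 2 + 2 * x ^ 2 := by nlinarith [sq_nonneg (x - y)]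
  · simp only [Pi.add_apply]
    rw [integral_add (h2.const_mul 2) (h1.const_mul 2), integral_const_mul, integral_const_mul]
    linarith [(hA.memLp_batchGrad_sub_stepsizeDraw hn w).2]

end Assumptions

end FOMAML

/-! ### Bias and second moment of the first-order direction -/

namespace FOMAML

namespace Assumptions

variable {d : ℕ} {I Θ : Type*} [MeasurableSpace I] [MeasurableSpace Θ] {p : Measure I}
  [IsProbabilityMeasure p]
  {P : Kernel I Θ} [IsMarkovKernel P] {f : I → Param d → ℝ} {g : I → Param d → Θ → Param d}
  {α L ρ σ σt : ℝ} {Din Dout : ℕ}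

theorem measurable_innerStep (hA : Assumptions p f P g α L ρ σ σt) {X : Type*}
    [MeasurableSpace X] {i : X → I} {w : X → Param d} {D : X → Fin Din → Θ} (hi : Measurable i)
    (hw : Measurable w) (hD : Measurable D) :
    Measurable fun x => w x - α • batchGrad g (i x) (w x) (D x) :=
  hw.sub ((hA.measurable_batchGrad_comp hi hw hD).const_smul α)

theorem measurable_foDirection (hA : Assumptions p f P g α L ρ σ σt) {X : Type*}
    [MeasurableSpace X] {w : X → Param d} {s : X → MetaDraw I Θ Din Dout} (hw : Measurable w)
    (hs : Measurable s) : Measurable fun x => foDirection g α (w x) (s x) :=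
  hA.measurable_batchGrad_comp hs.fst (hA.measurable_innerStep hs.fst hw hs.snd.fst) hs.snd.snd

/-- The noise of the outer dataset. -/
theorem memLp_foDirection_sub (hA : Assumptions p f P g α L ρ σ σt) (hDout : 0 < Dout)
    (w : Param d) :
    MemLp (fun s : MetaDraw I Θ Din Dout => foDirection g α w s -
        gradient (f s.1) (w - α • batchGrad g s.1 w s.2.1)) 2 (metaDrawLaw p P Din Dout) ∧
      ∫ s : MetaDraw I Θ Din Dout, ‖foDirection g α w s -
        gradient (f s.1) (w - α • batchGrad g s.1 w s.2.1)‖ ^ 2 ∂(metaDrawLaw p P Din Dout) ≤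
          σt ^ 2 / Dout := by
  have hm : Measurable fun s : MetaDraw I Θ Din Dout => foDirection g α w s -
        gradient (f s.1) (w - α • batchGrad g s.1 w s.2.1) :=
    (hA.measurable_foDirection measurable_const measurable_id).sub
      (hA.measurable_gradient_comp measurable_fst
        (hA.measurable_innerStep measurable_fst measurable_const measurable_snd.fst))
  refine memLp_two_and_integral_norm_sq_le' hm.aestronglyMeasurable (by positivity) ?_
  rw [lintegral_metaDrawLaw p P (hm.enorm.pow_const 2)]
  have h : ∀ (i : I) (u : Param d), ∫⁻ b, ‖batchGrad g i u b - gradient (f i) u‖ₑ ^ 2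
      ∂(Measure.pi fun _ : Fin Dout => P i) ≤ ENNReal.ofReal (σt ^ 2 / Dout) := fun i u =>
    lintegral_enorm_sq_le (Q := Measure.pi fun _ : Fin Dout => P i)
      ((hA.memLp_batchGrad i u).sub (memLp_const (gradient (f i) u)))
      (hA.integral_norm_batchGrad_sub_sq_le hDout i u)
  have h2 : ∀ i, ∫⁻ a : Fin Din → Θ, ∫⁻ b : Fin Dout → Θ, ‖foDirection g α w (i, (a, b)) -
        gradient (f i) (w - α • batchGrad g i w a)‖ₑ ^ 2 ∂(Measure.pi fun _ : Fin Dout => P i)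
          ∂(Measure.pi fun _ : Fin Din => P i) ≤ ENNReal.ofReal (σt ^ 2 / Dout) := by
    intro i
    refine (lintegral_mono fun a => h i (w - α • batchGrad g i w a)).trans_eq ?_
    rw [lintegral_const, measure_univ, mul_one]
  refine (lintegral_mono h2).trans_eq ?_
  rw [lintegral_const, measure_univ, mul_one]

theorem integral_foDirection_sub (hA : Assumptions p f P g α L ρ σ σt) (hDout : 0 < Dout)
    (w : Param d) :
    ∫ s : MetaDraw I Θ Din Dout, (foDirection g α w s -
        gradient (f s.1) (w - α • batchGrad g s.1 w s.2.1)) ∂(metaDrawLaw p P Din Dout) = 0 := by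
  refine integral_metaDrawLaw_eq_zero p P
    ((hA.memLp_foDirection_sub hDout w).1.integrable (by norm_num)) fun i a => ?_
  have h : Integrable (fun b : Fin Dout → Θ => foDirection g α w (i, (a, b)))
      (Measure.pi fun _ : Fin Dout => P i) :=
    (hA.memLp_batchGrad i (w - α • batchGrad g i w a)).integrable (by norm_num)
  have h2 : ∫ b : Fin Dout → Θ, foDirection g α w (i, (a, b)) ∂(Measure.pi fun _ => P i) =
      gradient (f i) (w - α • batchGrad g i w a) :=
    hA.integral_batchGrad hDout i (w - α • batchGrad g i w a)
  dsimp only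
  rw [integral_sub h (integrable_const _), h2, integral_const, probReal_univ, one_smul, sub_self]

theorem norm_gradient_innerStep_sub_le (hA : Assumptions p f P g α L ρ σ σt) (hα : 0 ≤ α)
    (hL : 0 ≤ L) (w : Param d) (i : I) (D : Fin Din → Θ) :
    ‖gradient (f i) (w - α • batchGrad g i w D) - adaptedGrad (f i) α w‖ ≤
      α * L * ‖batchGrad g i w D - gradient (f i) w‖ +
        α * L * ((1 + α * L) * ‖gradient (f i) w‖) := by
  have h1 := norm_adaptedGrad_sub_le hα hL (hA.grad_lipschitz i) w
  have h2 := hA.grad_lipschitz i (w - α • batchGrad g i w D) (w - α • gradient (f i) w)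
  rw [sub_sub_sub_cancel_left, ← smul_sub, norm_smul, Real.norm_of_nonneg hα,
    norm_sub_rev (gradient (f i) w)] at h2
  refine (norm_sub_le_norm_sub_add_norm_sub _
    (gradient (f i) (w - α • gradient (f i) w)) _).trans ?_
  rw [norm_sub_rev _ (adaptedGrad (f i) α w)]
  linarith

theorem norm_gradient_innerStep_le (hA : Assumptions p f P g α L ρ σ σt) (hα : 0 ≤ α)
    (hL : 0 ≤ L) (w : Param d) (i : I) (D : Fin Din → Θ) :
    ‖gradient (f i) (w - α • batchGrad g i w D)‖ ≤
      α * L * ‖batchGrad g i w D - gradient (f i) w‖ + (1 + α * L) * ‖gradient (f i) w‖ := by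
  have h1 := norm_gradient_sub_smul_le hα (hA.grad_lipschitz i) w (batchGrad g i w D)
  have h2 := norm_le_norm_add_norm_sub' (batchGrad g i w D) (gradient (f i) w)
  have h3 := norm_le_norm_add_norm_sub' (gradient (f i) (w - α • batchGrad g i w D))
    (gradient (f i) w)
  have h4 := mul_le_mul_of_nonneg_left h2 (mul_nonneg hα hL)
  linarith

theorem memLp_gradient_innerStep (hA : Assumptions p f P g α L ρ σ σt) (hα : 0 ≤ α)
    (hL : 0 ≤ L) (hDin : 0 < Din) (w : Param d) :
    MemLp (fun s : StepsizeDraw I Θ Din =>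
      gradient (f s.1) (w - α • batchGrad g s.1 w s.2)) 2 (stepsizeDrawLaw p P Din) := by
  have h1 := ((hA.memLp_batchGrad_sub_stepsizeDraw hDin w).1.norm.const_mul (α * L)).add
    ((hA.memLp_gradient_stepsizeDraw (n := Din) w).norm.const_mul (1 + α * L))
  refine h1.mono (hA.measurable_gradient_comp measurable_fst (hA.measurable_innerStep
    measurable_fst measurable_const measurable_snd)).aestronglyMeasurable
    (Filter.Eventually.of_forall fun s => ?_)
  exact (hA.norm_gradient_innerStep_le hα hL w s.1 s.2).trans (le_abs_self _)

theorem integral_norm_gradient_innerStep_sq_le (hA : Assumptions p f P g α L ρ σ σt) (hα : 0 ≤ α)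
    (hL : 0 ≤ L) (hDin : 0 < Din) (w : Param d) :
    ∫ s : StepsizeDraw I Θ Din, ‖gradient (f s.1) (w - α • batchGrad g s.1 w s.2)‖ ^ 2
        ∂(stepsizeDrawLaw p P Din) ≤
      2 * (α * L) ^ 2 * (σt ^ 2 / Din) + 2 * (1 + α * L) ^ 2 * ∫ i, ‖gradient (f i) w‖ ^ 2 ∂p := by
  have h1 := (hA.memLp_batchGrad_sub_stepsizeDraw hDin w).1.integrable_norm_pow (p := 2)
    (by norm_num)
  have h2 := (hA.memLp_gradient_stepsizeDraw (n := Din) w).integrable_norm_pow (p := 2)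
    (by norm_num)
  have h3 := integral_comp_measurePreserving (measurePreserving_fst_stepsizeDrawLaw p P Din)
    ((hA.memLp_gradient w).integrable_norm_pow (p := 2) (by norm_num)).aestronglyMeasurable
  refine (integral_mono ((hA.memLp_gradient_innerStep hα hL hDin w).integrable_norm_pow
    (by norm_num)) ((h1.const_mul (2 * (α * L) ^ 2)).add (h2.const_mul (2 * (1 + α * L) ^ 2)))
      fun s => ?_).trans ?_
  · have h := hA.norm_gradient_innerStep_le hα hL w s.1 s.2
    simp only [Pi.add_apply]
    set x := ‖batchGrad g s.1 w s.2 - gradient (f s.1) w‖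
    set y := ‖gradient (f s.1) w‖
    calc _ ≤ (α * L * x + (1 + α * L) * y) ^ 2 := by gcongr
      _ ≤ _ := by nlinarith [sq_nonneg (α * L * x - (1 + α * L) * y)]
  · simp only [Pi.add_apply]
    rw [integral_add (h1.const_mul _) (h2.const_mul _), integral_const_mul, integral_const_mul, h3]
    gcongr
    exact (hA.memLp_batchGrad_sub_stepsizeDraw hDin w).2

theorem memLp_gradient_innerStep_metaDraw (hA : Assumptions p f P g α L ρ σ σt) (hα : 0 ≤ α)
    (hL : 0 ≤ L) (hDin : 0 < Din) (w : Param d) :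
    MemLp (fun s : MetaDraw I Θ Din Dout =>
      gradient (f s.1) (w - α • batchGrad g s.1 w s.2.1)) 2 (metaDrawLaw p P Din Dout) :=
  (hA.memLp_gradient_innerStep hα hL hDin w).comp_measurePreserving
    (measurePreserving_metaDrawLaw p P Din Dout)

theorem memLp_foDirection (hA : Assumptions p f P g α L ρ σ σt) (hα : 0 ≤ α)
    (hL : 0 ≤ L) (hDin : 0 < Din) (hDout : 0 < Dout) (w : Param d) :
    MemLp (foDirection g α w) 2 (metaDrawLaw p P Din Dout) := by
  refine ((hA.memLp_foDirection_sub hDout w).1.add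
    (hA.memLp_gradient_innerStep_metaDraw hα hL hDin w)).congr_norm
    (hA.measurable_foDirection measurable_const measurable_id).aestronglyMeasurable
    (Filter.Eventually.of_forall fun s => ?_)
  simp

/-- The bias of the first-order direction. -/
theorem norm_integral_foDirection_sub_le (hA : Assumptions p f P g α L ρ σ σt) (hα : 0 ≤ α)
    (hL : 0 ≤ L) (hσt : 0 ≤ σt) (hDin : 0 < Din) (hDout : 0 < Dout) (w : Param d) :
    ‖∫ s, foDirection g α w s ∂(metaDrawLaw p P Din Dout) - gradient (metaObjective p f α) w‖ ≤
      α * L * (σt / √Din) + α * L * ((1 + α * L) * ∫ i, ‖gradient (f i) w‖ ∂p) := by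
  set Y : StepsizeDraw I Θ Din → Param d :=
    fun s => gradient (f s.1) (w - α • batchGrad g s.1 w s.2) with hY
  have hYint : Integrable Y (stepsizeDrawLaw p P Din) :=
    (hA.memLp_gradient_innerStep hα hL hDin w).integrable (by norm_num)
  -- Given the task and the inner dataset, the outer gradient is unbiased, so the outer dataset adds
  -- nothing to the bias.
  have e1 : ∫ s, foDirection g α w s ∂(metaDrawLaw p P Din Dout) =
      ∫ s, Y s ∂(stepsizeDrawLaw p P Din) := by
    rw [← integral_comp_measurePreserving (measurePreserving_metaDrawLaw p P Din Dout)
      hYint.aestronglyMeasurable, ← sub_eq_zero, ← integral_sub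
      ((hA.memLp_foDirection hα hL hDin hDout w).integrable (by norm_num))
      ((hA.memLp_gradient_innerStep_metaDraw hα hL hDin w).integrable (by norm_num))]
    exact hA.integral_foDirection_sub hDout w
  have hfst := measurePreserving_fst_stepsizeDrawLaw p P Din
  have hAG : Integrable (fun s : StepsizeDraw I Θ Din => adaptedGrad (f s.1) α w)
      (stepsizeDrawLaw p P Din) :=
    hfst.integrable_comp_of_integrable (hA.integrable_adaptedGrad hα hL w)
  have e2 : gradient (metaObjective p f α) w =
      ∫ s : StepsizeDraw I Θ Din, adaptedGrad (f s.1) α w ∂(stepsizeDrawLaw p P Din) := by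
    rw [hA.gradient_metaObjective hα hL]
    exact (integral_comp_measurePreserving hfst
      (hA.integrable_adaptedGrad hα hL w).aestronglyMeasurable).symm
  have h1 := ((hA.memLp_batchGrad_sub_stepsizeDraw hDin w).1.integrable (by norm_num)).norm
  have h2 := ((hA.memLp_gradient_stepsizeDraw (n := Din) w).integrable (by norm_num)).norm
  rw [e1, e2, ← integral_sub hYint hAG]
  refine (norm_integral_le_of_norm_le ((h1.const_mul (α * L)).add
    ((h2.const_mul (1 + α * L)).const_mul (α * L)))
    (Filter.Eventually.of_forall fun s =>
      hA.norm_gradient_innerStep_sub_le hα hL w s.1 s.2)).trans ?_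
  simp only [Pi.add_apply]
  rw [integral_add (h1.const_mul (α * L)) ((h2.const_mul (1 + α * L)).const_mul (α * L)),
    integral_const_mul, integral_const_mul, integral_const_mul,
    hA.integral_norm_gradient_stepsizeDraw]
  gcongr
  exact hA.integral_norm_batchGrad_sub_stepsizeDraw_le hσt hDin w

theorem integral_norm_foDirection_sq_le (hA : Assumptions p f P g α L ρ σ σt) (hα : 0 ≤ α)
    (hL : 0 ≤ L) (hDin : 0 < Din) (hDout : 0 < Dout) (w : Param d) :
    ∫ s, ‖foDirection g α w s‖ ^ 2 ∂(metaDrawLaw p P Din Dout) ≤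
      2 * (σt ^ 2 / Dout) + 4 * (α * L) ^ 2 * (σt ^ 2 / Din) +
        4 * (1 + α * L) ^ 2 * ∫ i, ‖gradient (f i) w‖ ^ 2 ∂p := by
  have h1 := (hA.memLp_foDirection_sub (Din := Din) hDout w).1.integrable_norm_pow (p := 2)
    (by norm_num)
  have h2 := (hA.memLp_gradient_innerStep_metaDraw (Dout := Dout) hα hL hDin
    w).integrable_norm_pow (p := 2) (by norm_num)
  have h3 := integral_comp_measurePreserving (measurePreserving_metaDrawLaw p P Din Dout)
    ((hA.memLp_gradient_innerStep hα hL hDin w).integrable_norm_pow (p := 2)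
      (by norm_num)).aestronglyMeasurable
  refine (integral_mono ((hA.memLp_foDirection hα hL hDin hDout w).integrable_norm_pow
    (by norm_num)) ((h1.const_mul 2).add (h2.const_mul 2)) fun s => ?_).trans ?_
  · simp only [Pi.add_apply]
    have h := norm_le_norm_add_norm_sub' (foDirection g α w s)
      (gradient (f s.1) (w - α • batchGrad g s.1 w s.2.1))
    set x := ‖foDirection g α w s - gradient (f s.1) (w - α • batchGrad g s.1 w s.2.1)‖
    set y := ‖gradient (f s.1) (w - α • batchGrad g s.1 w s.2.1)‖
    calc _ ≤ (y + x) ^ 2 := by gcongr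
      _ ≤ _ := by nlinarith [sq_nonneg (x - y)]
  · simp only [Pi.add_apply]
    rw [integral_add (h1.const_mul 2) (h2.const_mul 2), integral_const_mul, integral_const_mul, h3]
    have h4 := (hA.memLp_foDirection_sub (Din := Din) hDout w).2
    have h5 := hA.integral_norm_gradient_innerStep_sq_le hα hL hDin w
    linarith

variable {B : ℕ}

/-- The second moment of the average direction of a task batch. -/
theorem integral_norm_average_foDirection_sq_le (hA : Assumptions p f P g α L ρ σ σt) (hα : 0 ≤ α)
    (hL : 0 ≤ L) (hB : 0 < B) (hDin : 0 < Din) (hDout : 0 < Dout) (w : Param d) :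
    ∫ s : Fin B → MetaDraw I Θ Din Dout, ‖(B : ℝ)⁻¹ • ∑ b, foDirection g α w (s b)‖ ^ 2
        ∂(Measure.pi fun _ : Fin B => metaDrawLaw p P Din Dout) ≤
      ‖∫ s, foDirection g α w s ∂(metaDrawLaw p P Din Dout)‖ ^ 2 +
      (2 * (σt ^ 2 / Dout) + 4 * (α * L) ^ 2 * (σt ^ 2 / Din) +
        4 * (1 + α * L) ^ 2 * ∫ i, ‖gradient (f i) w‖ ^ 2 ∂p) / B := by
  have hG := hA.memLp_foDirection hα hL hDin hDout w
  rw [integral_norm_sq_eq (memLp_average hG), integral_average hB (hG.integrable (by norm_num)),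
    integral_norm_average_sub_sq hB hG, add_comm]
  gcongr
  refine (integral_norm_sub_integral_sq_le hG 0).trans ?_
  simpa using hA.integral_norm_foDirection_sq_le hα hL hDin hDout w

end Assumptions

end FOMAML

/-! ### Moments of the random stepsize -/

namespace FOMAML

section Inverse

variable {X : Type*} [MeasurableSpace X] {Q : Measure X} [IsProbabilityMeasure Q] {S : X → ℝ}
  {c : ℝ}

theorem integrable_inv_pow (hS : AEStronglyMeasurable S Q) (hc : 0 < c) (hcS : ∀ x, c ≤ S x)
    (n : ℕ) : Integrable (fun x => (S x)⁻¹ ^ n) Q := by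
  refine Integrable.of_bound ((hS.aemeasurable.inv.pow_const n).aestronglyMeasurable)
    (c⁻¹ ^ n) (Filter.Eventually.of_forall fun x => ?_)
  have h := hc.trans_le (hcS x)
  rw [Real.norm_of_nonneg (by positivity)]
  gcongr
  exact hcS x

/-- Jensen's inequality for the inverse, from its tangent at the mean: `S⁻¹ ≥ 2 M⁻¹ - S M⁻²`, that
is, `S (S⁻¹ - M⁻¹)² ≥ 0`. -/
theorem inv_integral_le_integral_inv (hS : MemLp S 2 Q) (hc : 0 < c) (hcS : ∀ x, c ≤ S x) :
    (∫ x, S x ∂Q)⁻¹ ≤ ∫ x, (S x)⁻¹ ∂Q := by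
  have hS1 : Integrable S Q := hS.integrable (by norm_num)
  set M := ∫ x, S x ∂Q with hM
  have hM0 : 0 < M := by
    have h := integral_mono (integrable_const c) hS1 hcS
    rw [integral_const, probReal_univ, one_smul] at h
    linarith
  have hinv : Integrable (fun x => (S x)⁻¹) Q := by
    simpa using integrable_inv_pow hS.aestronglyMeasurable hc hcS 1
  have h := integral_mono ((integrable_const (2 * M⁻¹)).sub (hS1.const_mul (M⁻¹ ^ 2))) hinv
    fun x => by
      have hx := hc.trans_le (hcS x)
      have hx1 : S x * (S x)⁻¹ = 1 := mul_inv_cancel₀ hx.ne'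
      have h0 : 0 ≤ S x * ((S x)⁻¹ - M⁻¹) ^ 2 := by positivity
      have h1 : S x * ((S x)⁻¹ - M⁻¹) ^ 2 = S x * (S x)⁻¹ * (S x)⁻¹ -
        2 * (S x * (S x)⁻¹) * M⁻¹ + S x * M⁻¹ ^ 2 := by ring
      rw [hx1] at h1
      simp only [Pi.sub_apply]
      linarith
  simp only [Pi.sub_apply] at h
  rw [integral_sub (integrable_const _) (hS1.const_mul _), integral_const, probReal_univ,
    one_smul, integral_const_mul, ← hM] at h
  have h1 : M⁻¹ ^ 2 * M = M⁻¹ := by field_simp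
  rw [h1] at h
  linarith

/-- A reverse of Jensen's inequality. Write `S⁻¹ = M⁻¹ (1 - z)` with `z = S⁻¹ (S - M)`, use `(1 -
z)² ≤ 2 + 2z²`, and bound the inverse inside `z` by `c⁻¹`. -/
theorem integral_inv_sq_le (hS : MemLp S 2 Q) (hc : 0 < c) (hcS : ∀ x, c ≤ S x) {v : ℝ}
    (hv : ∫ x, ‖S x - ∫ y, S y ∂Q‖ ^ 2 ∂Q ≤ v) :
    ∫ x, (S x)⁻¹ ^ 2 ∂Q ≤ 2 * (1 + v / c ^ 2) * (∫ x, S x ∂Q)⁻¹ ^ 2 := by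
  have hS1 : Integrable S Q := hS.integrable (by norm_num)
  set M := ∫ x, S x ∂Q with hM
  have hM0 : 0 < M := by
    have h := integral_mono (integrable_const c) hS1 hcS
    rw [integral_const, probReal_univ, one_smul] at h
    linarith
  have h2 : Integrable (fun x => ‖S x - M‖ ^ 2) Q :=
    (hS.sub (memLp_const M)).integrable_norm_pow (by norm_num)
  have h3 : Integrable (fun x => 2 * M⁻¹ ^ 2 * (1 + c⁻¹ ^ 2 * ‖S x - M‖ ^ 2)) Q :=
    ((integrable_const _).add (h2.const_mul _)).const_mul _
  have h := integral_mono (integrable_inv_pow hS.aestronglyMeasurable hc hcS 2) h3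
    fun x => by
      have hx := hc.trans_le (hcS x)
      have e : (S x)⁻¹ = M⁻¹ * (1 - (S x)⁻¹ * (S x - M)) := by field_simp; ring
      have e2 : (S x)⁻¹ ^ 2 ≤ c⁻¹ ^ 2 := by gcongr; exact hcS x
      have e3 : ((S x)⁻¹ * (S x - M)) ^ 2 ≤ c⁻¹ ^ 2 * (S x - M) ^ 2 := by
        rw [mul_pow]; gcongr
      simp only [Real.norm_eq_abs, sq_abs]
      rw [e, mul_pow, mul_comm 2, mul_assoc (M⁻¹ ^ 2)]
      gcongr
      nlinarith [sq_nonneg (1 + (S x)⁻¹ * (S x - M))]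
  refine h.trans ?_
  rw [integral_const_mul, integral_add (integrable_const _) (h2.const_mul _), integral_const,
    probReal_univ, one_smul, integral_const_mul]
  calc _ ≤ 2 * M⁻¹ ^ 2 * (1 + c⁻¹ ^ 2 * v) := by gcongr
    _ = _ := by field_simp

end Inverse

namespace Assumptions

variable {d : ℕ} {I Θ : Type*} [MeasurableSpace I] [MeasurableSpace Θ] {p : Measure I}
  [IsProbabilityMeasure p]
  {P : Kernel I Θ} [IsMarkovKernel P] {f : I → Param d → ℝ} {g : I → Param d → Θ → Param d}
  {α L ρ σ σt : ℝ} {B' Dβ : ℕ}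

theorem smoothnessEstimate_eq (w : Param d) (s : Fin B' → StepsizeDraw I Θ Dβ) :
    smoothnessEstimate g α L ρ w s =
      4 * L + 2 * ρ * α * ((B' : ℝ)⁻¹ • ∑ b, ‖batchGrad g (s b).1 w (s b).2‖) := by
  rw [smoothnessEstimate, smul_eq_mul]; ring

theorem le_smoothnessEstimate (hα : 0 ≤ α) (hρ : 0 ≤ ρ) (w : Param d)
    (s : Fin B' → StepsizeDraw I Θ Dβ) : 4 * L ≤ smoothnessEstimate g α L ρ w s := by
  have : 0 ≤ 2 * ρ * α / (B' : ℝ) * ∑ b, ‖batchGrad g (s b).1 w (s b).2‖ := by positivity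
  rw [smoothnessEstimate]; linarith

theorem stepsize_le (hα : 0 ≤ α) (hL : 0 < L) (hρ : 0 ≤ ρ) (w : Param d)
    (s : Fin B' → StepsizeDraw I Θ Dβ) : stepsize g α L ρ w s ≤ 1 / (72 * L) := by
  have h := le_smoothnessEstimate (g := g) (L := L) hα hρ w s
  have h2 : (smoothnessEstimate g α L ρ w s)⁻¹ ≤ (4 * L)⁻¹ := by gcongr
  rw [stepsize]
  calc _ ≤ (4 * L)⁻¹ / 18 := by gcongr
    _ = _ := by field_simp; norm_num

theorem measurable_smoothnessEstimate (hA : Assumptions p f P g α L ρ σ σt) {X : Type*}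
    [MeasurableSpace X] {w : X → Param d} {s : X → Fin B' → StepsizeDraw I Θ Dβ}
    (hw : Measurable w) (hs : Measurable s) :
    Measurable fun x => smoothnessEstimate g α L ρ (w x) (s x) := by
  have h : ∀ b, Measurable fun x => ‖batchGrad g (s x b).1 (w x) (s x b).2‖ := fun b =>
    (hA.measurable_batchGrad_comp ((measurable_pi_apply b).comp hs).fst hw
      ((measurable_pi_apply b).comp hs).snd).norm
  exact ((Finset.measurable_fun_sum _ fun b _ => h b).const_mul _).const_add _

theorem memLp_smoothnessEstimate (hA : Assumptions p f P g α L ρ σ σt) (hDβ : 0 < Dβ)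
    (w : Param d) :
    MemLp (fun s : Fin B' → StepsizeDraw I Θ Dβ => smoothnessEstimate g α L ρ w s) 2
      (Measure.pi fun _ : Fin B' => stepsizeDrawLaw p P Dβ) := by
  simp_rw [smoothnessEstimate_eq]
  exact (memLp_const (4 * L)).add
    ((memLp_average (hA.memLp_batchGrad_stepsizeDraw hDβ w).norm).const_mul (2 * ρ * α))

theorem integral_smoothnessEstimate (hA : Assumptions p f P g α L ρ σ σt) (hB' : 0 < B')
    (hDβ : 0 < Dβ) (w : Param d) :
    ∫ s : Fin B' → StepsizeDraw I Θ Dβ, smoothnessEstimate g α L ρ w s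
        ∂(Measure.pi fun _ : Fin B' => stepsizeDrawLaw p P Dβ) =
      4 * L + 2 * ρ * α * ∫ s : StepsizeDraw I Θ Dβ, ‖batchGrad g s.1 w s.2‖
        ∂(stepsizeDrawLaw p P Dβ) := by
  have hN := (hA.memLp_batchGrad_stepsizeDraw hDβ w).norm
  simp_rw [smoothnessEstimate_eq]
  rw [integral_add (integrable_const _)
    (((memLp_average hN).integrable (by norm_num)).const_mul (2 * ρ * α)), integral_const,
    probReal_univ, one_smul, integral_const_mul,
    integral_average hB' (hN.integrable (by norm_num))]

/-- The constant is `16 + 2`: the task variance contributes at most `16 L²` by the size of `B'`, the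
data variance at most `2 L²` by the size of `Dβ`. -/
theorem integral_norm_smoothnessEstimate_sub_sq_le (hA : Assumptions p f P g α L ρ σ σt)
    (hL : 0 < L) (hB' : 0 < B') (hDβ : 0 < Dβ) (hB'' : (1 / 2) * (ρ * α * σ / L) ^ 2 ≤ (B' : ℝ))
    (hDβ' : (2 * ρ * α * σt / L) ^ 2 ≤ (Dβ : ℝ)) (w : Param d) :
    ∫ s : Fin B' → StepsizeDraw I Θ Dβ, ‖smoothnessEstimate g α L ρ w s -
        ∫ s : Fin B' → StepsizeDraw I Θ Dβ, smoothnessEstimate g α L ρ w s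
          ∂(Measure.pi fun _ : Fin B' => stepsizeDrawLaw p P Dβ)‖ ^ 2
        ∂(Measure.pi fun _ : Fin B' => stepsizeDrawLaw p P Dβ) ≤ 18 * L ^ 2 := by
  have hN := (hA.memLp_batchGrad_stepsizeDraw hDβ w).norm
  have h1 := integral_norm_average_sub_sq hB' hN
  have h2 := hA.integral_norm_batchGrad_stepsizeDraw_variance_le hDβ w
  rw [hA.integral_smoothnessEstimate hB' hDβ]
  have key : ∀ s : Fin B' → StepsizeDraw I Θ Dβ, ‖smoothnessEstimate g α L ρ w s -
      (4 * L + 2 * ρ * α * ∫ s : StepsizeDraw I Θ Dβ, ‖batchGrad g s.1 w s.2‖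
        ∂(stepsizeDrawLaw p P Dβ))‖ ^ 2 = (2 * ρ * α) ^ 2 *
      ‖(B' : ℝ)⁻¹ • ∑ b, ‖batchGrad g (s b).1 w (s b).2‖ -
        ∫ s : StepsizeDraw I Θ Dβ, ‖batchGrad g s.1 w s.2‖ ∂(stepsizeDrawLaw p P Dβ)‖ ^ 2 := by
    intro s
    rw [smoothnessEstimate_eq, add_sub_add_left_eq_sub, ← mul_sub, norm_mul, mul_pow,
      Real.norm_eq_abs (2 * ρ * α), sq_abs]
  simp_rw [key]
  rw [integral_const_mul, h1]
  have hb : (0 : ℝ) < B' := by exact_mod_cast hB'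
  have hb1 : (1 : ℝ) ≤ B' := by exact_mod_cast hB'
  have hD : (0 : ℝ) < Dβ := by exact_mod_cast hDβ
  rw [div_pow] at hB'' hDβ'
  have e1 : (ρ * α * σ) ^ 2 ≤ 2 * B' * L ^ 2 := by
    have : (ρ * α * σ) ^ 2 / L ^ 2 ≤ 2 * B' := by linarith
    rwa [div_le_iff₀ (by positivity)] at this
  have e2 : (2 * ρ * α * σt) ^ 2 ≤ Dβ * L ^ 2 := by
    rwa [div_le_iff₀ (by positivity)] at hDβ'
  have e3 : (2 * ρ * α) ^ 2 * (2 * (σt ^ 2 / Dβ)) ≤ 2 * L ^ 2 := by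
    have : (2 * ρ * α) ^ 2 * (2 * (σt ^ 2 / Dβ)) = 2 * ((2 * ρ * α * σt) ^ 2 / Dβ) := by ring
    rw [this]
    have : (2 * ρ * α * σt) ^ 2 / Dβ ≤ L ^ 2 := by
      rw [div_le_iff₀ hD]; linarith
    linarith
  calc _ ≤ (2 * ρ * α) ^ 2 * ((2 * σ ^ 2 + 2 * (σt ^ 2 / Dβ)) / B') := by gcongr
    _ = ((8 * (ρ * α * σ) ^ 2) + (2 * ρ * α) ^ 2 * (2 * (σt ^ 2 / Dβ))) / B' := by ring
    _ ≤ (8 * (2 * B' * L ^ 2) + 2 * L ^ 2 * B') / B' := by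
        refine div_le_div_of_nonneg_right ?_ hb.le
        nlinarith [sq_nonneg L]
    _ = 18 * L ^ 2 := by field_simp; ring

/-- By the size of `Dβ` the data noise adds at most `L`, which is at most a quarter of `4L + 2ραe`.
-/
theorem integral_smoothnessEstimate_le (hA : Assumptions p f P g α L ρ σ σt)
    (hα : 0 ≤ α) (hL : 0 < L) (hρ : 0 ≤ ρ) (hσt : 0 ≤ σt) (hB' : 0 < B') (hDβ : 0 < Dβ)
    (hDβ' : (2 * ρ * α * σt / L) ^ 2 ≤ (Dβ : ℝ)) (w : Param d) :
    ∫ s : Fin B' → StepsizeDraw I Θ Dβ, smoothnessEstimate g α L ρ w s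
        ∂(Measure.pi fun _ : Fin B' => stepsizeDrawLaw p P Dβ) ≤
      5 / 4 * (4 * L + 2 * ρ * α * ∫ i, ‖gradient (f i) w‖ ∂p) := by
  rw [hA.integral_smoothnessEstimate hB' hDβ]
  have hD : (0 : ℝ) < Dβ := by exact_mod_cast hDβ
  have h1 := hA.integral_norm_batchGrad_stepsizeDraw_le hσt hDβ w
  have h0 : 0 ≤ ∫ i, ‖gradient (f i) w‖ ∂p := integral_nonneg fun i => norm_nonneg _
  have h2 : 2 * ρ * α * σt / L ≤ √Dβ := Real.le_sqrt_of_sq_le hDβ'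
  have h3 : 2 * ρ * α * (σt / √Dβ) ≤ L := by
    rw [div_le_iff₀ hL] at h2
    rw [← mul_div_assoc, div_le_iff₀ (Real.sqrt_pos.2 hD)]
    linarith
  have h4 := mul_le_mul_of_nonneg_left h1 (by positivity : 0 ≤ 2 * ρ * α)
  have h5 : 0 ≤ 2 * ρ * α * ∫ i, ‖gradient (f i) w‖ ∂p := by positivity
  linarith

theorem le_integral_smoothnessEstimate (hA : Assumptions p f P g α L ρ σ σt)
    (hα : 0 ≤ α) (hρ : 0 ≤ ρ) (hB' : 0 < B') (hDβ : 0 < Dβ) (w : Param d) :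
    4 * L + 2 * ρ * α * ∫ i, ‖gradient (f i) w‖ ∂p ≤
      ∫ s : Fin B' → StepsizeDraw I Θ Dβ, smoothnessEstimate g α L ρ w s
        ∂(Measure.pi fun _ : Fin B' => stepsizeDrawLaw p P Dβ) := by
  rw [hA.integral_smoothnessEstimate hB' hDβ]
  have h1 := hA.le_integral_norm_batchGrad_stepsizeDraw hDβ w
  gcongr

theorem integrable_stepsize_pow (hA : Assumptions p f P g α L ρ σ σt)
    (hα : 0 ≤ α) (hL : 0 < L) (hρ : 0 ≤ ρ) (w : Param d) (n : ℕ) :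
    Integrable (fun s : Fin B' → StepsizeDraw I Θ Dβ => stepsize g α L ρ w s ^ n)
      (Measure.pi fun _ : Fin B' => stepsizeDrawLaw p P Dβ) := by
  simp_rw [stepsize, div_pow]
  exact (integrable_inv_pow (hA.measurable_smoothnessEstimate measurable_const
    measurable_id).aestronglyMeasurable (by positivity : 0 < 4 * L)
    (fun s => le_smoothnessEstimate hα hρ w s) n).div_const _

/-- Here `2/45` is `4/5 · 1/18`. -/
theorem le_integral_stepsize (hA : Assumptions p f P g α L ρ σ σt)
    (hα : 0 ≤ α) (hL : 0 < L) (hρ : 0 ≤ ρ) (hσt : 0 ≤ σt) (hB' : 0 < B') (hDβ : 0 < Dβ)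
    (hDβ' : (2 * ρ * α * σt / L) ^ 2 ≤ (Dβ : ℝ)) (w : Param d) :
    2 / 45 * (4 * L + 2 * ρ * α * ∫ i, ‖gradient (f i) w‖ ∂p)⁻¹ ≤
      ∫ s : Fin B' → StepsizeDraw I Θ Dβ, stepsize g α L ρ w s
        ∂(Measure.pi fun _ : Fin B' => stepsizeDrawLaw p P Dβ) := by
  have h0 : 0 ≤ ∫ i, ‖gradient (f i) w‖ ∂p := integral_nonneg fun i => norm_nonneg _
  have hΛ : 0 < 4 * L + 2 * ρ * α * ∫ i, ‖gradient (f i) w‖ ∂p := by positivity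
  have h1 := hA.integral_smoothnessEstimate_le hα hL hρ hσt hB' hDβ hDβ' w
  have h2 := hA.le_integral_smoothnessEstimate (L := L) hα hρ hB' hDβ w
  have h3 := inv_integral_le_integral_inv (hA.memLp_smoothnessEstimate (B' := B') hDβ w)
    (by positivity : 0 < 4 * L) (fun s => le_smoothnessEstimate hα hρ w s)
  set Λ := 4 * L + 2 * ρ * α * ∫ i, ‖gradient (f i) w‖ ∂p
  simp_rw [stepsize]
  rw [integral_div]
  have h4 : (5 / 4 * Λ)⁻¹ ≤ (∫ s : Fin B' → StepsizeDraw I Θ Dβ, smoothnessEstimate g α L ρ w s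
        ∂(Measure.pi fun _ : Fin B' => stepsizeDrawLaw p P Dβ))⁻¹ :=
    inv_anti₀ (hΛ.trans_le h2) h1
  rw [mul_inv] at h4
  linarith

/-- Here `17/1296` is `2 (1 + 18/16) / 18²`, from variance `18 L²` and lower bound `4 L`. -/
theorem integral_stepsize_sq_le (hA : Assumptions p f P g α L ρ σ σt)
    (hα : 0 ≤ α) (hL : 0 < L) (hρ : 0 ≤ ρ) (hB' : 0 < B') (hDβ : 0 < Dβ)
    (hB'' : (1 / 2) * (ρ * α * σ / L) ^ 2 ≤ (B' : ℝ))
    (hDβ' : (2 * ρ * α * σt / L) ^ 2 ≤ (Dβ : ℝ)) (w : Param d) :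
    ∫ s : Fin B' → StepsizeDraw I Θ Dβ, stepsize g α L ρ w s ^ 2
        ∂(Measure.pi fun _ : Fin B' => stepsizeDrawLaw p P Dβ) ≤
      17 / 1296 * (4 * L + 2 * ρ * α * ∫ i, ‖gradient (f i) w‖ ∂p)⁻¹ ^ 2 := by
  have h0 : 0 ≤ ∫ i, ‖gradient (f i) w‖ ∂p := integral_nonneg fun i => norm_nonneg _
  have hΛ : 0 < 4 * L + 2 * ρ * α * ∫ i, ‖gradient (f i) w‖ ∂p := by positivity
  have h2 := hA.le_integral_smoothnessEstimate (L := L) hα hρ hB' hDβ w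
  have h3 := integral_inv_sq_le (hA.memLp_smoothnessEstimate (B' := B') hDβ w)
    (by positivity : 0 < 4 * L) (fun s => le_smoothnessEstimate hα hρ w s)
    (hA.integral_norm_smoothnessEstimate_sub_sq_le hL hB' hDβ hB'' hDβ' w)
  set Λ := 4 * L + 2 * ρ * α * ∫ i, ‖gradient (f i) w‖ ∂p
  simp_rw [stepsize, div_pow]
  rw [integral_div]
  have h4 : (∫ s : Fin B' → StepsizeDraw I Θ Dβ, smoothnessEstimate g α L ρ w s
        ∂(Measure.pi fun _ : Fin B' => stepsizeDrawLaw p P Dβ))⁻¹ ^ 2 ≤ Λ⁻¹ ^ 2 := by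
    exact pow_le_pow_left₀ (inv_nonneg.2 (hΛ.trans_le h2).le) (inv_anti₀ hΛ h2) 2
  have h5 : 2 * (1 + 18 * L ^ 2 / (4 * L) ^ 2) = 17 / 4 := by field_simp; norm_num
  rw [h5] at h3
  linarith

end Assumptions

end FOMAML

/-! ### Scalar inequalities behind one iteration -/

namespace FOMAML

section Estimates

variable {x e n q δ u σ D Λ L K : ℝ}

/-- `n` and `e` are the norm of the mean task gradient and the mean norm of the task gradients,
`x` is the norm of the meta-gradient. -/
theorem mean_norm_le (he : 0 ≤ e) (hu : 0 ≤ u) (hu' : u ≤ 1 / 10)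
    (hn : n ≤ x + u * (2 + u) * e) (hen : e ≤ n + σ) :
    e ≤ 127 / 100 * (x + σ) ∧ n ≤ 127 / 100 * x + 27 / 100 * σ := by
  have h1 : u * (2 + u) ≤ 21 / 100 := by nlinarith
  have h2 : u * (2 + u) * e ≤ 21 / 100 * e := by gcongr
  have h3 : e ≤ 100 / 79 * (x + σ) := by linarith
  constructor <;> linarith

/-- Here `u = αL`. Its factor turns `σ` into the target accuracy `uσ` and leaves a coefficient of
`x` well below 1, so that the mean direction still descends. -/
theorem bias_le (hx : 0 ≤ x) (hσ : 0 ≤ σ) (hu : 0 ≤ u) (hu' : u ≤ 1 / 10) (hD : 1 ≤ D)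
    (he : e ≤ 127 / 100 * (x + σ)) {τ : ℝ} (hτ : τ ≤ D * (u * σ))
    (hδ : δ ≤ u * τ + u * ((1 + u) * e)) :
    δ ≤ 14 / 100 * x + 3 / 2 * D * (u * σ) := by
  have h0 : 0 ≤ u * σ := by positivity
  have h1 : u * τ ≤ 1 / 10 * (D * (u * σ)) := by
    calc u * τ ≤ u * (D * (u * σ)) := by gcongr
      _ ≤ 1 / 10 * (D * (u * σ)) := by gcongr
  have h2 : u * ((1 + u) * e) ≤ u * (11 / 10 * (127 / 100 * (x + σ))) := by
    have : (1 + u) * e ≤ 11 / 10 * (127 / 100 * (x + σ)) := by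
      calc (1 + u) * e ≤ (1 + u) * (127 / 100 * (x + σ)) := by gcongr
        _ ≤ _ := by gcongr; linarith
    gcongr
  have h3 : u * x ≤ 1 / 10 * x := by gcongr
  have h4 : u * σ ≤ D * (u * σ) := le_mul_of_one_le_left h0 hD
  linarith

/-- The variance produces `x²` only through `q / B`, where `B ≥ 20` keeps its share below `8/10 x²`.
The spread `σ²` has no small factor of its own and needs `B` of order `1/u²`, which is `hσB`. -/
theorem direction_sq_le (hσ : 0 ≤ σ) (hu : 0 ≤ u) (hu' : u ≤ 1 / 10) (hD : 1 ≤ D)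
    (hn0 : 0 ≤ n) (hn : n ≤ 127 / 100 * x + 27 / 100 * σ) (hq : q ≤ n ^ 2 + σ ^ 2)
    (hδ : δ ≤ 14 / 100 * x + 3 / 2 * D * (u * σ)) {y r₁ r₂ B : ℝ} (hy0 : 0 ≤ y) (hy : y ≤ x + δ)
    (hB : 20 ≤ B) (hr₁ : r₁ / B ≤ D * (u * σ) ^ 2) (hr₂ : r₂ ≤ D * (u * σ) ^ 2)
    (hσB : σ ^ 2 / B ≤ D * (u * σ) ^ 2) :
    y ^ 2 + (2 * r₁ + 4 * u ^ 2 * r₂ + 4 * (1 + u) ^ 2 * q) / B ≤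
      5 / 2 * x ^ 2 + 19 * D ^ 2 * (u * σ) ^ 2 := by
  set ε := u * σ with hε
  have hε0 : 0 ≤ ε := by positivity
  have hB0 : 0 < B := by linarith
  have hDε : D * ε ^ 2 ≤ D ^ 2 * ε ^ 2 := by
    gcongr
    exact le_self_pow₀ hD (by norm_num)
  have h1 : y ^ 2 ≤ 13 / 8 * x ^ 2 + 45 / 4 * D ^ 2 * ε ^ 2 := by
    calc y ^ 2 ≤ (114 / 100 * x + 3 / 2 * D * ε) ^ 2 := by gcongr; linarith
      _ ≤ _ := by linarith [sq_nonneg (57 / 100 * x - 3 * (D * ε)), sq_nonneg x]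
  have h2 : q ≤ 323 / 100 * x ^ 2 + 115 / 100 * σ ^ 2 := by
    have : n ^ 2 ≤ (127 / 100 * x + 27 / 100 * σ) ^ 2 := by gcongr
    linarith [sq_nonneg (127 / 100 * x - 27 / 100 * σ), sq_nonneg x, sq_nonneg σ]
  have h3 : (2 * r₁ + 4 * u ^ 2 * r₂ + 4 * (1 + u) ^ 2 * q) / B =
      2 * (r₁ / B) + 4 * u ^ 2 * r₂ / B + 4 * (1 + u) ^ 2 * (q / B) := by ring
  have h4 : 4 * u ^ 2 * r₂ / B ≤ 4 / 2000 * (D * ε ^ 2) := by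
    rw [div_le_iff₀ hB0]
    have hu2 : u ^ 2 ≤ 1 / 100 := by
      calc u ^ 2 ≤ (1 / 10) ^ 2 := by gcongr
        _ = 1 / 100 := by norm_num
    have hDe : 0 ≤ D * ε ^ 2 := by positivity
    calc 4 * u ^ 2 * r₂ ≤ 4 * u ^ 2 * (D * ε ^ 2) := by gcongr
      _ ≤ 4 * (1 / 100) * (D * ε ^ 2) := by gcongr
      _ = 4 / 2000 * (D * ε ^ 2) * 20 := by ring
      _ ≤ _ := by gcongr
  have h5 : q / B ≤ 323 / 2000 * x ^ 2 + 115 / 100 * (D * ε ^ 2) := by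
    calc q / B ≤ (323 / 100 * x ^ 2 + 115 / 100 * σ ^ 2) / B := by gcongr
      _ = 323 / 100 * (x ^ 2 / B) + 115 / 100 * (σ ^ 2 / B) := by ring
      _ ≤ 323 / 100 * (x ^ 2 / 20) + 115 / 100 * (D * ε ^ 2) := by gcongr
      _ = _ := by ring
  have h6 : 4 * (1 + u) ^ 2 * (q / B) ≤
      484 / 100 * (323 / 2000 * x ^ 2 + 115 / 100 * (D * ε ^ 2)) := by
    have hu2 : 4 * (1 + u) ^ 2 ≤ 484 / 100 := by
      calc 4 * (1 + u) ^ 2 ≤ 4 * (1 + 1 / 10) ^ 2 := by gcongr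
        _ = 484 / 100 := by norm_num
    have : 0 ≤ 323 / 2000 * x ^ 2 + 115 / 100 * (D * ε ^ 2) := by positivity
    calc _ ≤ 4 * (1 + u) ^ 2 * (323 / 2000 * x ^ 2 + 115 / 100 * (D * ε ^ 2)) := by gcongr
      _ ≤ _ := by gcongr
  have h7 : 0 ≤ D ^ 2 * ε ^ 2 := by positivity
  rw [h3]
  linarith [sq_nonneg x]

/-- The expected decrease in one iteration: `b₁`, `b₂` are the moments of the stepsize, `J` is the
inner product of the mean direction with the meta-gradient, `V` the second moment of the
direction. -/
theorem decrease_le {ε b₁ b₂ J V t a b : ℝ} (hL : 0 < L) (hx : 0 ≤ x) (hε : 0 ≤ ε) (hD : 1 ≤ D)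
    (hδ : δ ≤ 14 / 100 * x + 3 / 2 * D * ε) (hJ : x ^ 2 - x * δ ≤ J)
    (hV0 : 0 ≤ V) (hV : V ≤ 5 / 2 * x ^ 2 + 19 * D ^ 2 * ε ^ 2)
    (hΛL : 4 * L ≤ Λ) (hΛ : Λ ≤ L * (a + b * x))
    (hb₁ : 2 / 45 * Λ⁻¹ ≤ b₁) (hb₁' : b₁ ≤ 1 / (72 * L))
    (hb₂ : b₂ ≤ 17 / 1296 * Λ⁻¹ ^ 2) (ht0 : 0 ≤ t) (ht1 : t ≤ 1) (htb : t * ε * b ≤ 1)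
    (ha : 0 ≤ a) :
    -(b₁ * J) + 55 / 100 * Λ * (b₂ * V) ≤
      -(17 / 1000 * t * (ε / L) * x) + (a + D ^ 2) * (ε ^ 2 / L) := by
  have hΛ0 : 0 < Λ := by linarith
  have hb₁0 : 0 ≤ b₁ := le_trans (by positivity) hb₁
  have hΛinv : Λ⁻¹ ≤ (4 * L)⁻¹ := inv_anti₀ (by positivity) hΛL
  have hJ' : 8 / 10 * x ^ 2 - 94 / 10 * (D ^ 2 * ε ^ 2) ≤ J := by
    have : x * δ ≤ x * (14 / 100 * x + 3 / 2 * D * ε) := by gcongr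
    linarith [sq_nonneg (x - 25 / 2 * (D * ε)), sq_nonneg (D * ε)]
  have hDε : 0 ≤ D ^ 2 * ε ^ 2 := by positivity
  have e1 : -(b₁ * J) ≤ -(16 / 450 * Λ⁻¹ * x ^ 2) + 131 / 1000 * (D ^ 2 * (ε ^ 2 / L)) := by
    have f1 : b₁ * (8 / 10 * x ^ 2 - 94 / 10 * (D ^ 2 * ε ^ 2)) ≤ b₁ * J := by gcongr
    have f2 : 2 / 45 * Λ⁻¹ * x ^ 2 ≤ b₁ * x ^ 2 := by gcongr
    have f3 : b₁ * (D ^ 2 * ε ^ 2) ≤ 1 / (72 * L) * (D ^ 2 * ε ^ 2) := by gcongr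
    have f4 : 1 / (72 * L) * (D ^ 2 * ε ^ 2) = 1 / 72 * (D ^ 2 * (ε ^ 2 / L)) := by
      field_simp
    have f5 : 0 ≤ D ^ 2 * (ε ^ 2 / L) := by positivity
    linarith
  have e2 : 55 / 100 * Λ * (b₂ * V) ≤
      1804 / 100000 * (Λ⁻¹ * x ^ 2) + 35 / 1000 * (D ^ 2 * (ε ^ 2 / L)) := by
    have hV' : 0 ≤ 5 / 2 * x ^ 2 + 19 * D ^ 2 * ε ^ 2 := by positivity
    have f1 : Λ * (b₂ * V) ≤
        Λ * (17 / 1296 * Λ⁻¹ ^ 2 * (5 / 2 * x ^ 2 + 19 * D ^ 2 * ε ^ 2)) := by gcongr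
    have f2 : Λ * (17 / 1296 * Λ⁻¹ ^ 2 * (5 / 2 * x ^ 2 + 19 * D ^ 2 * ε ^ 2)) =
        17 / 1296 * (5 / 2 * (Λ⁻¹ * x ^ 2) + 19 * (Λ⁻¹ * (D ^ 2 * ε ^ 2))) := by
      field_simp
    have f3 : Λ⁻¹ * (D ^ 2 * ε ^ 2) ≤ (4 * L)⁻¹ * (D ^ 2 * ε ^ 2) := by gcongr
    have f4 : (4 * L)⁻¹ * (D ^ 2 * ε ^ 2) = 1 / 4 * (D ^ 2 * (ε ^ 2 / L)) := by
      field_simp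
    have f5 : 0 ≤ D ^ 2 * (ε ^ 2 / L) := by positivity
    have f6 : 0 ≤ Λ⁻¹ * x ^ 2 := by positivity
    rw [f2] at f1
    rw [f4] at f3
    linarith
  -- Completing the square with `t(ε/L)Λ` gives `2t(ε/L)x` minus `(tε/L)²Λ`. The part of the latter
  -- that grows with `x` is absorbed by half of the gain, as `tεb ≤ 1`.
  have e3 : t * (ε / L) * x - a * (ε ^ 2 / L) ≤ Λ⁻¹ * x ^ 2 := by
    have g1 : 0 ≤ Λ⁻¹ * (x - t * (ε / L) * Λ) ^ 2 := by positivity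
    have g2 : Λ⁻¹ * (x - t * (ε / L) * Λ) ^ 2 =
        Λ⁻¹ * x ^ 2 - 2 * t * (ε / L) * x + (t * (ε / L)) ^ 2 * Λ := by
      field_simp
      ring
    have g3 : (t * (ε / L)) ^ 2 * Λ ≤ (t * (ε / L)) ^ 2 * (L * (a + b * x)) := by gcongr
    have g4 : (t * (ε / L)) ^ 2 * (L * (a + b * x)) =
        t ^ 2 * (a * (ε ^ 2 / L)) + (t * ε * b) * (t * (ε / L) * x) := by
      field_simp
    have g5 : (t * ε * b) * (t * (ε / L) * x) ≤ 1 * (t * (ε / L) * x) := by gcongr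
    have g6 : t ^ 2 * (a * (ε ^ 2 / L)) ≤ 1 * (a * (ε ^ 2 / L)) := by
      gcongr
      exact pow_le_one₀ ht0 ht1
    linarith
  have h1 : 0 ≤ Λ⁻¹ * x ^ 2 := by positivity
  have h2 : 0 ≤ D ^ 2 * (ε ^ 2 / L) := by positivity
  have h3 : 0 ≤ a * (ε ^ 2 / L) := by positivity
  -- The quadratic gain exceeds the quadratic loss: `16/450 - 1804/100000 > 17/1000`.
  linarith

/-- Combines the preceding inequalities in the form in which the integrals supply them. Here `y` is
the norm of the mean direction and `q` the mean squared norm of the task gradients. -/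
theorem expected_decrease_le {α ρ σt B Din Dout b t y J V b₁ b₂ : ℝ} (hα : 0 < α) (hL : 0 < L)
    (hρ : 0 ≤ ρ) (hσ : 0 ≤ σ) (hαL : α * L ≤ 1 / 10) (hDin : 0 ≤ Din) (hB : 20 ≤ B)
    (hD : 1 ≤ D) (hσB : σ ^ 2 / B ≤ D * (α * L * σ) ^ 2)
    (hσtDin : σt ^ 2 / Din ≤ D * (α * L * σ) ^ 2)
    (hσtB : σt ^ 2 / Dout / B ≤ D * (α * L * σ) ^ 2)
    (hK : 0 ≤ K) (hσK : σ ≤ 1 + K) (hρK : ρ * α ≤ K * L) (hb : b = 254 / 100 * K)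
    (ht0 : 0 ≤ t) (ht1 : t ≤ 1) (htb : t * (α * L * σ) * b ≤ 1)
    (hx : 0 ≤ x) (he : 0 ≤ e) (hn0 : 0 ≤ n) (hn : n ≤ x + α * L * (2 + α * L) * e)
    (hen : e ≤ n + σ) (hq : q ≤ n ^ 2 + σ ^ 2)
    (hδ : δ ≤ α * L * (σt / √Din) + α * L * ((1 + α * L) * e))
    (hy0 : 0 ≤ y) (hy : y ≤ x + δ) (hJ : x ^ 2 - x * δ ≤ J) (hV0 : 0 ≤ V)
    (hV : V ≤ y ^ 2 + (2 * (σt ^ 2 / Dout) + 4 * (α * L) ^ 2 * (σt ^ 2 / Din) +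
      4 * (1 + α * L) ^ 2 * q) / B)
    (hb₁ : 2 / 45 * (4 * L + 2 * ρ * α * e)⁻¹ ≤ b₁) (hb₁' : b₁ ≤ 1 / (72 * L))
    (hb₂ : b₂ ≤ 17 / 1296 * (4 * L + 2 * ρ * α * e)⁻¹ ^ 2) :
    -(b₁ * J) + 55 / 100 * (4 * L + 2 * ρ * α * e) * (b₂ * V) ≤
      -(17 / 1000 * t * (α * σ) * x) +
        (4 + b * (1 + K) + D ^ 2) * (α ^ 2 * σ ^ 2 * L) := by
  have hu : 0 ≤ α * L := by positivity
  have hε0 : 0 ≤ α * L * σ := by positivity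
  have hb0 : 0 ≤ b := by rw [hb]; positivity
  obtain ⟨he', hn'⟩ := mean_norm_le he hu hαL hn hen
  have hτ : σt / √Din ≤ D * (α * L * σ) := by
    refine abs_le_of_sq_le_sq' ?_ (by positivity) |>.2
    rw [div_pow, Real.sq_sqrt hDin, mul_pow]
    refine hσtDin.trans ?_
    gcongr
    exact le_self_pow₀ hD (by norm_num)
  have hδ' := bias_le hx hσ hu hαL hD he' hτ hδ
  have hV' := hV.trans
    (direction_sq_le hσ hu hαL hD hn0 hn' hq hδ' hy0 hy hB hσtB hσtDin hσB)
  have hΛL : 4 * L ≤ 4 * L + 2 * ρ * α * e := le_add_of_nonneg_right (by positivity)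
  -- The `254/100` in `b` is twice the `127/100` of `mean_norm_le`, and `σ` is replaced by its bound
  -- `1 + K`.
  have hΛ : 4 * L + 2 * ρ * α * e ≤ L * (4 + b * (1 + K) + b * x) := by
    have h1 : ρ * α * e ≤ K * L * (127 / 100 * (x + (1 + K))) := by
      have : e ≤ 127 / 100 * (x + (1 + K)) := by linarith only [he', hσK]
      gcongr
    rw [hb]
    linarith only [h1]
  have hdec := decrease_le hL hx hε0 hD hδ' hJ hV0 hV' hΛL hΛ hb₁ hb₁' hb₂ ht0 ht1 htb
    (by positivity)
  have hε1 : α * L * σ / L = α * σ := by field_simp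
  have hε2 : (α * L * σ) ^ 2 / L = α ^ 2 * σ ^ 2 * L := by field_simp
  rwa [hε1, hε2] at hdec

end Estimates

end FOMAML

/-! ### Expected decrease in one iteration -/

namespace FOMAML

namespace Assumptions

variable {d : ℕ} {I Θ : Type*} [MeasurableSpace I] [MeasurableSpace Θ] {p : Measure I}
  [IsProbabilityMeasure p]
  {P : Kernel I Θ} [IsMarkovKernel P] {f : I → Param d → ℝ} {g : I → Param d → Θ → Param d}
  {α L ρ σ σt : ℝ} {B Din Dout B' Dβ : ℕ}

theorem foStep_eq (w : Param d) (s : IterDraw I Θ B Din Dout B' Dβ) :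
    foStep g α L ρ w s =
      w - stepsize g α L ρ w s.2 • ((B : ℝ)⁻¹ • ∑ b, foDirection g α w (s.1 b)) := by
  rw [foStep, smul_smul, div_eq_mul_inv]

theorem measurable_foStep (hA : Assumptions p f P g α L ρ σ σt) {X : Type*}
    [MeasurableSpace X] {w : X → Param d} {s : X → IterDraw I Θ B Din Dout B' Dβ}
    (hw : Measurable w) (hs : Measurable s) : Measurable fun x => foStep g α L ρ (w x) (s x) := by
  have h1 : Measurable fun x => stepsize g α L ρ (w x) (s x).2 :=
    (hA.measurable_smoothnessEstimate hw hs.snd).inv.div_const 18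
  have h2 : ∀ b, Measurable fun x => foDirection g α (w x) ((s x).1 b) := fun b =>
    hA.measurable_foDirection hw ((measurable_pi_apply b).comp hs.fst)
  exact hw.sub ((h1.div_const (B : ℝ)).smul (Finset.measurable_fun_sum _ fun b _ => h2 b))

theorem metaObjective_foStep_le (hA : Assumptions p f P g α L ρ σ σt) (hα : 0 ≤ α)
    (hL : 0 < L) (hρ : 0 ≤ ρ) (hαL : α * L ≤ 1 / 10) (w : Param d)
    (s : IterDraw I Θ B Din Dout B' Dβ) :
    metaObjective p f α (foStep g α L ρ w s) ≤ metaObjective p f α w +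
      (-(inner ℝ (gradient (metaObjective p f α) w)
          ((B : ℝ)⁻¹ • ∑ b, foDirection g α w (s.1 b)) * stepsize g α L ρ w s.2) +
      55 / 100 * (4 * L + 2 * ρ * α * ∫ i, ‖gradient (f i) w‖ ∂p) *
        (‖(B : ℝ)⁻¹ • ∑ b, foDirection g α w (s.1 b)‖ ^ 2 * stepsize g α L ρ w s.2 ^ 2)) := by
  have h := hA.metaObjective_le hα hL.le hρ w (foStep g α L ρ w s)
  have hM : 0 ≤ ∫ i, ‖gradient (f i) w‖ ∂p := integral_nonneg fun i => norm_nonneg _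
  rw [foStep_eq, sub_sub_cancel_left, norm_neg, inner_neg_right, inner_smul_right, norm_smul,
    mul_pow, Real.norm_eq_abs, sq_abs] at h
  rw [foStep_eq]
  set G := (B : ℝ)⁻¹ • ∑ b, foDirection g α w (s.1 b)
  set β := stepsize g α L ρ w s.2
  set e := ∫ i, ‖gradient (f i) w‖ ∂p
  have h0 : 0 ≤ α * L := by positivity
  -- The second term forces the `55/100`, as `1 + αL ≤ 11/10`; the first has room to spare.
  have h1 : (1 + α * L) ^ 2 * L + α * ρ * (1 + α * L) * e ≤
      55 / 100 * (4 * L + 2 * ρ * α * e) := by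
    have e1 : (1 + α * L) ^ 2 * L ≤ (1 + 1 / 10) ^ 2 * L := by gcongr
    have e2 : α * ρ * (1 + α * L) * e ≤ α * ρ * (1 + 1 / 10) * e := by gcongr
    linarith
  have h2 : ((1 + α * L) ^ 2 * L + α * ρ * (1 + α * L) * e) * (β ^ 2 * ‖G‖ ^ 2) ≤
      55 / 100 * (4 * L + 2 * ρ * α * e) * (β ^ 2 * ‖G‖ ^ 2) := by gcongr
  linarith

/-- Lower integrals of `F - inf F` spare any integrability of `F` along the iterates; the decrease
`A` stands on the left to avoid truncated subtraction. -/
theorem lintegral_foStep_add_le_of_moments (hA : Assumptions p f P g α L ρ σ σt) (hα : 0 ≤ α)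
    (hL : 0 < L) (hρ : 0 ≤ ρ) (hαL : α * L ≤ 1 / 10)
    (hDin : 0 < Din) (hDout : 0 < Dout) (hB : 0 < B) (w : Param d) {A c : ℝ}
    (hA0 : 0 ≤ A) (hc0 : 0 ≤ c)
    (h : -((∫ s : Fin B' → StepsizeDraw I Θ Dβ, stepsize g α L ρ w s
            ∂(Measure.pi fun _ : Fin B' => stepsizeDrawLaw p P Dβ)) *
          inner ℝ (gradient (metaObjective p f α) w)
            (∫ s, foDirection g α w s ∂(metaDrawLaw p P Din Dout))) +
        55 / 100 * (4 * L + 2 * ρ * α * ∫ i, ‖gradient (f i) w‖ ∂p) *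
          ((∫ s : Fin B' → StepsizeDraw I Θ Dβ, stepsize g α L ρ w s ^ 2
            ∂(Measure.pi fun _ : Fin B' => stepsizeDrawLaw p P Dβ)) *
          ∫ s : Fin B → MetaDraw I Θ Din Dout, ‖(B : ℝ)⁻¹ • ∑ b, foDirection g α w (s b)‖ ^ 2
            ∂(Measure.pi fun _ : Fin B => metaDrawLaw p P Din Dout)) ≤ -A + c) :
    ∫⁻ s, ENNReal.ofReal (metaObjective p f α (foStep g α L ρ w s) - ⨅ u, metaObjective p f α u)
        ∂(iterDrawLaw p P B Din Dout B' Dβ) + ENNReal.ofReal A ≤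
    ENNReal.ofReal (metaObjective p f α w - ⨅ u, metaObjective p f α u) + ENNReal.ofReal c := by
  set F := metaObjective p f α
  have hinf : ∀ u, 0 ≤ F u - ⨅ u, F u := fun u => sub_nonneg.2 (ciInf_le hA.bddBelow u)
  set Λ := 4 * L + 2 * ρ * α * ∫ i, ‖gradient (f i) w‖ ∂p
  set v := gradient F w
  set M := Measure.pi fun _ : Fin B => metaDrawLaw p P Din Dout
  set N := Measure.pi fun _ : Fin B' => stepsizeDrawLaw p P Dβ
  set G : (Fin B → MetaDraw I Θ Din Dout) → Param d :=
    fun s => (B : ℝ)⁻¹ • ∑ b, foDirection g α w (s b)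
  have hdir := hA.memLp_foDirection hα hL.le hDin hDout w
  have hG2 : MemLp G 2 M := memLp_average hdir
  have hG1 : Integrable G M := hG2.integrable (by norm_num)
  have hJ : ∫ s, inner ℝ v (G s) ∂M =
      inner ℝ v (∫ s, foDirection g α w s ∂(metaDrawLaw p P Din Dout)) := by
    rw [integral_inner hG1]
    exact congrArg _ (integral_average hB (hdir.integrable (by norm_num)))
  have hst := fun n => hA.integrable_stepsize_pow (B' := B') (Dβ := Dβ) hα hL hρ w n
  have hst1 : Integrable (fun s : Fin B' → StepsizeDraw I Θ Dβ => stepsize g α L ρ w s) N := by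
    simpa using hst 1
  have i1 : Integrable (fun s : IterDraw I Θ B Din Dout B' Dβ =>
      inner ℝ v (G s.1) * stepsize g α L ρ w s.2) (M.prod N) :=
    (hG1.const_inner v).mul_prod hst1
  have i1' : Integrable (fun s : IterDraw I Θ B Din Dout B' Dβ =>
      -(inner ℝ v (G s.1) * stepsize g α L ρ w s.2)) (M.prod N) := i1.neg
  have i2 : Integrable (fun s : IterDraw I Θ B Din Dout B' Dβ =>
      ‖G s.1‖ ^ 2 * stepsize g α L ρ w s.2 ^ 2) (M.prod N) :=
    (hG2.integrable_norm_pow (by norm_num)).mul_prod (hst 2)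
  have i3 : Integrable (fun s : IterDraw I Θ B Din Dout B' Dβ =>
      -(inner ℝ v (G s.1) * stepsize g α L ρ w s.2) +
      55 / 100 * Λ * (‖G s.1‖ ^ 2 * stepsize g α L ρ w s.2 ^ 2)) (M.prod N) :=
    i1'.add (i2.const_mul _)
  set R : IterDraw I Θ B Din Dout B' Dβ → ℝ := fun s => (F w - ⨅ u, F u) +
    (-(inner ℝ v (G s.1) * stepsize g α L ρ w s.2) +
      55 / 100 * Λ * (‖G s.1‖ ^ 2 * stepsize g α L ρ w s.2 ^ 2)) with hR
  have hRint : Integrable R (M.prod N) := (integrable_const _).add i3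
  have hRval : ∫ s, R s ∂(M.prod N) ≤ (F w - ⨅ u, F u) + (-A + c) := by
    rw [hR, integral_add (integrable_const _) i3, integral_add i1' (i2.const_mul _),
      integral_neg, integral_const_mul, integral_const, probReal_univ, one_smul,
      integral_prod_mul (fun s => inner ℝ v (G s)) (fun s => stepsize g α L ρ w s),
      integral_prod_mul (fun s => ‖G s‖ ^ 2) (fun s => stepsize g α L ρ w s ^ 2), hJ,
      mul_comm (inner ℝ v _), mul_comm (∫ s, ‖G s‖ ^ 2 ∂M)]
    gcongr
  have hstep : ∀ s, F (foStep g α L ρ w s) - ⨅ u, F u ≤ R s := by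
    intro s
    have := hA.metaObjective_foStep_le hα hL hρ hαL w s
    simp only [hR]
    linarith only [this]
  -- The bound `R` dominates a nonnegative quantity, so its Bochner integral and its lower integral
  -- agree.
  have hR0 : ∀ s, 0 ≤ R s := fun s => (hinf _).trans (hstep s)
  calc _ ≤ ∫⁻ s, ENNReal.ofReal (R s) ∂(M.prod N) + ENNReal.ofReal A := by
        exact add_le_add (lintegral_mono fun s => ENNReal.ofReal_le_ofReal (hstep s)) le_rfl
    _ = ENNReal.ofReal (∫ s, R s ∂(M.prod N) + A) := by
        rw [← ofReal_integral_eq_lintegral_ofReal hRint (Filter.Eventually.of_forall hR0),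
          ENNReal.ofReal_add (integral_nonneg hR0) hA0]
    _ ≤ ENNReal.ofReal ((F w - ⨅ u, F u) + c) := by
        refine ENNReal.ofReal_le_ofReal ?_
        linarith only [hRval]
    _ = _ := ENNReal.ofReal_add (hinf w) hc0

theorem lintegral_foStep_add_le (hA : Assumptions p f P g α L ρ σ σt) (hα : 0 < α)
    (hL : 0 < L) (hρ : 0 ≤ ρ) (hσ : 0 ≤ σ) (hσt : 0 ≤ σt) (hαL : α * L ≤ 1 / 10)
    (hDin : 0 < Din) (hDout : 0 < Dout) (hB' : 0 < B') (hDβ : 0 < Dβ) (hB : 20 ≤ B)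
    (hB'' : (1 / 2) * (ρ * α * σ / L) ^ 2 ≤ (B' : ℝ))
    (hDβ' : (2 * ρ * α * σt / L) ^ 2 ≤ (Dβ : ℝ)) {D K b t : ℝ}
    (hD : 1 ≤ D) (hσB : σ ^ 2 / B ≤ D * (α * L * σ) ^ 2)
    (hσtDin : σt ^ 2 / Din ≤ D * (α * L * σ) ^ 2)
    (hσtB : σt ^ 2 / Dout / B ≤ D * (α * L * σ) ^ 2)
    (hK : 0 ≤ K) (hσK : σ ≤ 1 + K) (hρK : ρ * α ≤ K * L) (hb : b = 254 / 100 * K)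
    (ht0 : 0 ≤ t) (ht1 : t ≤ 1) (htb : t * (α * L * σ) * b ≤ 1) (w : Param d) :
    ∫⁻ s, ENNReal.ofReal (metaObjective p f α (foStep g α L ρ w s) - ⨅ u, metaObjective p f α u)
        ∂(iterDrawLaw p P B Din Dout B' Dβ) +
      ENNReal.ofReal (17 / 1000 * t * (α * σ) * ‖gradient (metaObjective p f α) w‖) ≤
    ENNReal.ofReal (metaObjective p f α w - ⨅ u, metaObjective p f α u) +
      ENNReal.ofReal ((4 + b * (1 + K) + D ^ 2) * (α ^ 2 * σ ^ 2 * L)) := by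
  have hB0 : 0 < B := by omega
  have hb0 : 0 ≤ b := by rw [hb]; positivity
  refine hA.lintegral_foStep_add_le_of_moments hα.le hL hρ hαL hDin hDout hB0 w
    (by positivity) (by positivity) ?_
  have hJ : ∀ v m : Param d, ‖v‖ ^ 2 - ‖v‖ * ‖m - v‖ ≤ inner ℝ v m := by
    intro v m
    have h1 : inner ℝ v m = ‖v‖ ^ 2 + inner ℝ v (m - v) := by
      rw [inner_sub_right, real_inner_self_eq_norm_sq]; ring
    have h2 := (abs_le.1 (abs_real_inner_le_norm v (m - v))).1
    rw [h1]
    linarith only [h2]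
  have hb₁' : ∫ s : Fin B' → StepsizeDraw I Θ Dβ, stepsize g α L ρ w s
      ∂(Measure.pi fun _ : Fin B' => stepsizeDrawLaw p P Dβ) ≤ 1 / (72 * L) := by
    have h1 := hA.integrable_stepsize_pow (B' := B') (Dβ := Dβ) hα.le hL hρ w 1
    simp only [pow_one] at h1
    refine (integral_mono h1 (integrable_const _)
      fun s => stepsize_le hα.le hL hρ w s).trans_eq ?_
    rw [integral_const, probReal_univ, one_smul]
  exact expected_decrease_le hα hL hρ hσ hαL (Nat.cast_nonneg Din) (by exact_mod_cast hB) hD hσB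
    hσtDin hσtB hK hσK hρK hb ht0 ht1 htb (norm_nonneg _) (integral_nonneg fun i => norm_nonneg _)
    (norm_nonneg _)
    ((norm_le_norm_add_norm_sub' _ _).trans
      (add_le_add le_rfl (hA.norm_integral_gradient_sub_le hα.le hL.le w)))
    (hA.integral_norm_gradient_le hσ w) (hA.integral_norm_gradient_sq_le w)
    (hA.norm_integral_foDirection_sub_le hα.le hL.le hσt hDin hDout w) (norm_nonneg _)
    (norm_le_norm_add_norm_sub' _ _) (hJ _ _) (integral_nonneg fun s => sq_nonneg _)
    (hA.integral_norm_average_foDirection_sq_le hα.le hL.le hB0 hDin hDout w)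
    (hA.le_integral_stepsize hα.le hL hρ hσt hB' hDβ hDβ' w) hb₁'
    (hA.integral_stepsize_sq_le hα.le hL hρ hB' hDβ hB'' hDβ' w)

end Assumptions

end FOMAML

/-! ### Independence along the iterates and the potential argument -/

namespace FOMAML

section Iterates

variable {d : ℕ} {I Θ Ω : Type*}
  {g : I → Param d → Θ → Param d} {α L ρ : ℝ} {B Din Dout B' Dβ : ℕ}

theorem foIterate_congr (w₀ : Param d) {s s' : ℕ → IterDraw I Θ B Din Dout B' Dβ} {k : ℕ}
    (h : ∀ n < k, s n = s' n) :
    foIterate g α L ρ w₀ s k = foIterate g α L ρ w₀ s' k := by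
  induction k with
  | zero => rfl
  | succ k ih =>
    rw [foIterate, foIterate, ih fun n hn => h n (hn.trans k.lt_succ_self), h k k.lt_succ_self]

variable [MeasurableSpace I] [MeasurableSpace Θ] [MeasurableSpace Ω] {p : Measure I}
  [IsProbabilityMeasure p] {P : Kernel I Θ} [IsMarkovKernel P] {f : I → Param d → ℝ}
  {σ σt : ℝ}

theorem Assumptions.measurable_foIterate (hA : Assumptions p f P g α L ρ σ σt) (w₀ : Param d)
    {X : Type*} [MeasurableSpace X] {s : ℕ → X → IterDraw I Θ B Din Dout B' Dβ}
    (hs : ∀ k, Measurable (s k)) (k : ℕ) :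
    Measurable fun x => foIterate g α L ρ w₀ (fun n => s n x) k := by
  induction k with
  | zero => exact measurable_const
  | succ k ih => exact hA.measurable_foStep ih (hs k)

variable {μ : Measure Ω} [IsProbabilityMeasure μ] {ξ : ℕ → Ω → IterDraw I Θ B Din Dout B' Dβ}

/-- The iterate `k` is a measurable function of the draws with index below `k`. -/
theorem Assumptions.indepFun_foIterate (hA : Assumptions p f P g α L ρ σ σt) (w₀ : Param d)
    (hξ : ∀ k, Measurable (ξ k)) (hind : iIndepFun ξ μ) (k : ℕ) :
    IndepFun (fun ω => foIterate g α L ρ w₀ (fun n => ξ n ω) k) (ξ k) μ := by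
  classical
  have hΩ : Nonempty Ω := nonempty_of_isProbabilityMeasure μ
  obtain ⟨ω₀⟩ := hΩ
  have h := hind.indepFun_finset (Finset.range k) {k} (by simp) hξ
  -- Extends finitely many draws to a sequence. The value beyond `k` is arbitrary: iterate `k` does
  -- not see it.
  set ext : ℕ → ((i : Finset.range k) → IterDraw I Θ B Din Dout B' Dβ) →
      IterDraw I Θ B Din Dout B' Dβ :=
    fun n t => if hn : n ∈ Finset.range k then t ⟨n, hn⟩ else ξ 0 ω₀ with hext
  have hmeas : ∀ n, Measurable (ext n) := by
    intro n
    by_cases hn : n ∈ Finset.range k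
    · simp only [hext, hn, dif_pos]
      exact measurable_pi_apply _
    · simp only [hext, hn, dif_neg, not_false_eq_true]
      exact measurable_const
  have h2 := h.comp (hA.measurable_foIterate w₀ hmeas k)
    (measurable_pi_apply (⟨k, Finset.mem_singleton_self k⟩ : ({k} : Finset ℕ)))
  refine h2.congr (Filter.Eventually.of_forall fun ω => ?_) (Filter.Eventually.of_forall fun ω => rfl)
  refine foIterate_congr w₀ fun n hn => ?_
  simp [hext, hn]

theorem Assumptions.lintegral_foIterate_succ (hA : Assumptions p f P g α L ρ σ σt)
    (w₀ : Param d) (hξ : ∀ k, Measurable (ξ k)) (hind : iIndepFun ξ μ)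
    (hlaw : ∀ k, Measure.map (ξ k) μ = iterDrawLaw p P B Din Dout B' Dβ)
    {φ : Param d → ENNReal} (hφ : Measurable φ) (k : ℕ) :
    ∫⁻ ω, φ (foIterate g α L ρ w₀ (fun n => ξ n ω) (k + 1)) ∂μ =
      ∫⁻ ω, ∫⁻ s, φ (foStep g α L ρ (foIterate g α L ρ w₀ (fun n => ξ n ω) k) s)
        ∂(iterDrawLaw p P B Din Dout B' Dβ) ∂μ := by
  have hw := hA.measurable_foIterate w₀ hξ k
  have hψ : Measurable fun x : Param d × IterDraw I Θ B Din Dout B' Dβ =>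
      φ (foStep g α L ρ x.1 x.2) := hφ.comp (hA.measurable_foStep measurable_fst measurable_snd)
  have h := (indepFun_iff_map_prod_eq_prod_map_map hw.aemeasurable
    (hξ k).aemeasurable).1 (hA.indepFun_foIterate w₀ hξ hind k)
  rw [hlaw k] at h
  calc _ = ∫⁻ x, φ (foStep g α L ρ x.1 x.2) ∂(Measure.map (fun ω =>
        (foIterate g α L ρ w₀ (fun n => ξ n ω) k, ξ k ω)) μ) := by
        rw [lintegral_map hψ (hw.prodMk (hξ k))]; rfl
    _ = _ := by
        rw [h, lintegral_prod _ hψ.aemeasurable, lintegral_map hψ.lintegral_prod_right' hw]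

end Iterates

/-- Summing a one-step decrease. -/
theorem add_sum_range_le {E X : ℕ → ENNReal} {c : ENNReal}
    (h : ∀ k, E (k + 1) + X k ≤ E k + c) (N : ℕ) :
    E N + ∑ k ∈ Finset.range N, X k ≤ E 0 + N * c := by
  induction N with
  | zero => simp
  | succ N ih =>
    rw [Finset.sum_range_succ, add_comm (∑ k ∈ Finset.range N, X k), ← add_assoc]
    calc _ ≤ E N + c + ∑ k ∈ Finset.range N, X k := add_le_add (h N) le_rfl
      _ = E N + ∑ k ∈ Finset.range N, X k + c := by ring
      _ ≤ E 0 + N * c + c := add_le_add ih le_rfl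
      _ = _ := by push_cast; ring

/-- If the nonnegative variables `Y k` are small enough to be paid by a decrease of a potential
with initial value `Δ`, up to an error `κ₂ η` in each step, then one of the first ones has a small
mean. -/
theorem exists_integral_le {Ω : Type*} [MeasurableSpace Ω] {μ : Measure Ω}
    {Y : ℕ → Ω → ℝ} (hY : ∀ k, Measurable (Y k)) (hY0 : ∀ k ω, 0 ≤ Y k ω) {E : ℕ → ENNReal}
    {Δ κ₁ κ₂ a L C : ℝ} (hΔ : 0 ≤ Δ) (hκ₁ : 0 < κ₁) (hκ₂ : 0 ≤ κ₂) (ha : 0 < a) (hL : 0 < L)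
    (hC1 : 1 ≤ C) (hC : κ₂ + 1 ≤ κ₁ * C) (hE0 : E 0 ≤ ENNReal.ofReal Δ)
    (h : ∀ k, E (k + 1) + ∫⁻ ω, ENNReal.ofReal (κ₁ * a * Y k ω) ∂μ ≤
      E k + ENNReal.ofReal (κ₂ * (a ^ 2 * L))) :
    ∃ k : ℕ, (k : ℝ) ≤ Δ * (C * (1 / (a ^ 2 * L))) ∧ Integrable (Y k) μ ∧
      ∫ ω, Y k ω ∂μ ≤ C * (a * L) := by
  have hsum := add_sum_range_le h
  -- Each term is at most the telescoped sum, so the decrease itself yields the integrability of `Y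
  -- k`.
  have hfin : ∀ k, ∫⁻ ω, ENNReal.ofReal (κ₁ * a * Y k ω) ∂μ < ⊤ := by
    intro k
    have h1 : ∫⁻ ω, ENNReal.ofReal (κ₁ * a * Y k ω) ∂μ ≤
        ∑ k ∈ Finset.range (k + 1), ∫⁻ ω, ENNReal.ofReal (κ₁ * a * Y k ω) ∂μ :=
      Finset.single_le_sum (f := fun k => ∫⁻ ω, ENNReal.ofReal (κ₁ * a * Y k ω) ∂μ)
        (fun _ _ => zero_le) (Finset.self_mem_range_succ k)
    refine (h1.trans (le_add_self.trans (hsum (k + 1)))).trans_lt ?_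
    refine ENNReal.add_lt_top.2 ⟨hE0.trans_lt ENNReal.ofReal_lt_top, ?_⟩
    exact ENNReal.mul_lt_top (ENNReal.natCast_lt_top _) ENNReal.ofReal_lt_top
  have hint : ∀ k, Integrable (Y k) μ := by
    intro k
    have h1 : Integrable (fun ω => κ₁ * a * Y k ω) μ := by
      refine ⟨((hY k).const_mul _).aestronglyMeasurable, ?_⟩
      rw [hasFiniteIntegral_iff_ofReal (Filter.Eventually.of_forall fun ω =>
        mul_nonneg (by positivity) (hY0 k ω))]
      exact hfin k
    exact (integrable_const_mul_iff (by positivity : κ₁ * a ≠ 0).isUnit _).1 h1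
  have hval : ∀ k, ∫⁻ ω, ENNReal.ofReal (κ₁ * a * Y k ω) ∂μ =
      ENNReal.ofReal (κ₁ * a * ∫ ω, Y k ω ∂μ) := by
    intro k
    rw [← integral_const_mul, ofReal_integral_eq_lintegral_ofReal ((hint k).const_mul _)
      (Filter.Eventually.of_forall fun ω => mul_nonneg (by positivity) (hY0 k ω))]
  by_contra! hcon
  set r := Δ * (C * (1 / (a ^ 2 * L))) with hr
  have hη : 0 < a ^ 2 * L := by positivity
  have hr0 : 0 ≤ r := by positivity
  -- The indices below `N` are exactly those at most `r`, and `N` itself exceeds `r`.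
  set N := ⌊r⌋₊ + 1 with hN
  have hbig : ∀ k ∈ Finset.range N, ENNReal.ofReal (κ₁ * a * (C * (a * L))) ≤
      ∫⁻ ω, ENNReal.ofReal (κ₁ * a * Y k ω) ∂μ := by
    intro k hk
    have hk' : (k : ℝ) ≤ r := by
      have : k ≤ ⌊r⌋₊ := Nat.lt_succ_iff.1 (Finset.mem_range.1 hk)
      exact (Nat.cast_le.2 this).trans (Nat.floor_le hr0)
    rw [hval k]
    have := hcon k hk' (hint k)
    gcongr
  have h1 := (Finset.sum_le_sum hbig).trans (le_add_self.trans (hsum N))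
  rw [Finset.sum_const, Finset.card_range, nsmul_eq_mul] at h1
  have h2 : ENNReal.ofReal (N * (κ₁ * a * (C * (a * L)))) ≤
      ENNReal.ofReal (Δ + N * (κ₂ * (a ^ 2 * L))) := by
    rw [ENNReal.ofReal_add hΔ (by positivity), ENNReal.ofReal_mul (by positivity),
      ENNReal.ofReal_mul (by positivity : (0 : ℝ) ≤ N), ENNReal.ofReal_natCast]
    exact h1.trans (add_le_add hE0 le_rfl)
  rw [ENNReal.ofReal_le_ofReal_iff (by positivity)] at h2
  have hNr : r < N := by
    rw [hN]; push_cast; exact Nat.lt_floor_add_one r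
  have h3 : Δ * C < N * (a ^ 2 * L) := by
    have : r = Δ * C / (a ^ 2 * L) := by rw [hr]; ring
    rwa [this, div_lt_iff₀ hη] at hNr
  -- After the errors `κ₂` are paid, a surplus of `a²L` per step remains, in total at most `Δ`; but
  -- `N a²L > ΔC ≥ Δ`.
  have h4 : (κ₂ + 1) * (N * (a ^ 2 * L)) ≤ κ₁ * C * (N * (a ^ 2 * L)) := by gcongr
  have h5 : Δ ≤ Δ * C := le_mul_of_one_le_right hΔ hC1
  linarith

end FOMAML

/-! ### Choice of the constants and conclusion -/

theorem corollary2 (K C₁ C₂ : ℝ) (hK : 0 < K) (hC₁ : 0 < C₁) (hC₂ : 0 < C₂) :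
    ∃ C : ℝ, 0 < C ∧
      ∀ (d : ℕ) (I Θ Ω : Type*) [MeasurableSpace I] [MeasurableSpace Θ] [MeasurableSpace Ω]
        (p : Measure I) [IsProbabilityMeasure p] (P : Kernel I Θ) [IsMarkovKernel P]
        (f : I → FOMAML.Param d → ℝ) (g : I → FOMAML.Param d → Θ → FOMAML.Param d)
        (α L ρ σ σt : ℝ) (B Din Dout B' Dβ : ℕ) (w₀ : FOMAML.Param d)
        (μ : Measure Ω) [IsProbabilityMeasure μ]
        (ξ : ℕ → Ω → FOMAML.IterDraw I Θ B Din Dout B' Dβ),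
        0 < L → 0 ≤ ρ → 0 < σ → 0 ≤ σt → 0 < α → α ≤ 1 / (10 * L) →
        FOMAML.Assumptions p f P g α L ρ σ σt →
        ρ * α / L ≤ K → σ ^ 2 + σt ^ 2 ≤ K →
        0 < Din → 0 < Dout → 0 < B' → 0 < Dβ →
        ⌈(1 / 2) * (ρ * α * σ / L) ^ 2⌉₊ ≤ B' → ⌈(2 * ρ * α * σt / L) ^ 2⌉₊ ≤ Dβ →
        20 ≤ B →
        C₁ * (1 / (α ^ 2 * L ^ 2)) ≤ (B : ℝ) →
        C₂ * (σt ^ 2 / (α ^ 2 * σ ^ 2 * L ^ 2)) ≤ (Din : ℝ) →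
        C₂ * (σt ^ 2 / (α ^ 2 * σ ^ 2 * L ^ 2)) ≤ (B : ℝ) * (Dout : ℝ) →
        (∀ k, Measurable (ξ k)) →
        iIndepFun ξ μ →
        (∀ k, Measure.map (ξ k) μ = FOMAML.iterDrawLaw p P B Din Dout B' Dβ) →
        Differentiable ℝ (FOMAML.metaObjective p f α) ∧
        ∃ k : ℕ,
          (k : ℝ) ≤ (FOMAML.metaObjective p f α w₀ - ⨅ w, FOMAML.metaObjective p f α w) *
            (C * (1 / (α ^ 2 * σ ^ 2 * L))) ∧
          Integrable (fun ω => ‖gradient (FOMAML.metaObjective p f α)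
            (FOMAML.foIterate g α L ρ w₀ (fun n => ξ n ω) k)‖) μ ∧
          ∫ ω, ‖gradient (FOMAML.metaObjective p f α)
            (FOMAML.foIterate g α L ρ w₀ (fun n => ξ n ω) k)‖ ∂μ ≤ C * (α * σ * L) := by
  set b := 254 / 100 * K with hb
  -- Makes `D`, `D C₁` and `D C₂` at least 1, so that each batch-size condition bounds its noise
  -- term by `D (αLσ)²`.
  set D := 1 + C₁⁻¹ + C₂⁻¹ with hD
  -- Since `αLσ ≤ 1 + K`, this gives the condition `t (αLσ) b ≤ 1` of `decrease_le`.
  set t := (1 + b * (1 + K))⁻¹ with ht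
  have hb0 : 0 < b := by positivity
  have ht0 : 0 < t := by positivity
  have ht1 : t ≤ 1 := inv_le_one_of_one_le₀ (le_add_of_nonneg_right (by positivity))
  have hD1 : 1 ≤ D := by rw [hD, add_assoc]; exact le_add_of_nonneg_right (by positivity)
  have hDC₁ : 1 ≤ D * C₁ := by
    have : D * C₁ = 1 + (C₁ + C₂⁻¹ * C₁) := by rw [hD]; field_simp; ring
    rw [this]; exact le_add_of_nonneg_right (by positivity)
  have hDC₂ : 1 ≤ D * C₂ := by
    have : D * C₂ = 1 + (C₂ + C₁⁻¹ * C₂) := by rw [hD]; field_simp; ring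
    rw [this]; exact le_add_of_nonneg_right (by positivity)
  set κ₁ := 17 / 1000 * t with hκ₁
  set κ₂ := 4 + b * (1 + K) + D ^ 2 with hκ₂
  have hκ₁0 : 0 < κ₁ := by positivity
  have hκ₂0 : 0 ≤ κ₂ := by positivity
  -- Chosen so that `C ≥ 1` and `κ₁ C ≥ κ₂ + 1`, as `exists_integral_le` requires.
  refine ⟨1 + (κ₂ + 1) / κ₁, by positivity, ?_⟩
  intro d I Θ Ω _ _ _ p _ P _ f g α L ρ σ σt B Din Dout B' Dβ w₀ μ _ ξ hL hρ hσ hσt hα hαL' hA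
    hρK hσK hDin hDout hB' hDβ hB'' hDβ' hB hBC hDinC hBDC hξ hind hlaw
  refine ⟨hA.differentiable_metaObjective hα.le hL.le, ?_⟩
  have hαL : α * L ≤ 1 / 10 := by
    rw [le_div_iff₀ (by positivity)] at hαL'
    linarith
  have hσK' : σ ≤ 1 + K := by nlinarith [sq_nonneg σt]
  have hρK' : ρ * α ≤ K * L := by rwa [div_le_iff₀ hL] at hρK
  have hB0 : (0 : ℝ) < B := by
    have : 0 < B := by omega
    exact_mod_cast this
  have hDin0 : (0 : ℝ) < Din := by exact_mod_cast hDin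
  have hDout0 : (0 : ℝ) < Dout := by exact_mod_cast hDout
  have hσB : σ ^ 2 / B ≤ D * (α * L * σ) ^ 2 := by
    rw [mul_one_div, div_le_iff₀ (by positivity)] at hBC
    rw [div_le_iff₀ hB0]
    calc σ ^ 2 = 1 * σ ^ 2 := (one_mul _).symm
      _ ≤ D * C₁ * σ ^ 2 := by gcongr
      _ ≤ D * (B * (α ^ 2 * L ^ 2)) * σ ^ 2 := by gcongr
      _ = _ := by ring
  have hσtN : ∀ N : ℝ, C₂ * (σt ^ 2 / (α ^ 2 * σ ^ 2 * L ^ 2)) ≤ N →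
      σt ^ 2 ≤ D * (α * L * σ) ^ 2 * N := by
    intro N hN
    rw [← mul_div_assoc, div_le_iff₀ (by positivity)] at hN
    calc σt ^ 2 = 1 * σt ^ 2 := (one_mul _).symm
      _ ≤ D * C₂ * σt ^ 2 := by gcongr
      _ = D * (C₂ * σt ^ 2) := by ring
      _ ≤ D * (N * (α ^ 2 * σ ^ 2 * L ^ 2)) := by gcongr
      _ = _ := by ring
  have hσtDin : σt ^ 2 / Din ≤ D * (α * L * σ) ^ 2 := by
    rw [div_le_iff₀ hDin0]; exact hσtN _ hDinC
  have hσtB : σt ^ 2 / Dout / B ≤ D * (α * L * σ) ^ 2 := by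
    rw [div_div, div_le_iff₀ (by positivity), mul_comm (Dout : ℝ)]; exact hσtN _ hBDC
  have htb : t * (α * L * σ) * b ≤ 1 := by
    have h1 : α * L * σ ≤ 1 + K := by
      calc α * L * σ ≤ 1 / 10 * (1 + K) := by gcongr
        _ ≤ 1 + K := by linarith
    calc t * (α * L * σ) * b ≤ t * (1 + K) * b := by gcongr
      _ ≤ t * (1 + b * (1 + K)) := by linarith
      _ = 1 := inv_mul_cancel₀ (by positivity)
  have hFm : Measurable (FOMAML.metaObjective p f α) :=
    (hA.differentiable_metaObjective hα.le hL.le).continuous.measurable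
  have hgm : Measurable (gradient (FOMAML.metaObjective p f α)) :=
    (hA.continuous_gradient_metaObjective hα.le hL.le).measurable
  have hw := hA.measurable_foIterate w₀ hξ
  have hYm : ∀ k, Measurable fun ω => ENNReal.ofReal (κ₁ * (α * σ) *
      ‖gradient (FOMAML.metaObjective p f α)
        (FOMAML.foIterate g α L ρ w₀ (fun n => ξ n ω) k)‖) :=
    fun k => ((hgm.comp (hw k)).norm.const_mul _).ennreal_ofReal
  have hstep := FOMAML.exists_integral_le (μ := μ)
    (Y := fun k ω => ‖gradient (FOMAML.metaObjective p f α)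
      (FOMAML.foIterate g α L ρ w₀ (fun n => ξ n ω) k)‖)
    (E := fun k => ∫⁻ ω, ENNReal.ofReal (FOMAML.metaObjective p f α
      (FOMAML.foIterate g α L ρ w₀ (fun n => ξ n ω) k) - ⨅ w, FOMAML.metaObjective p f α w) ∂μ)
    (Δ := FOMAML.metaObjective p f α w₀ - ⨅ w, FOMAML.metaObjective p f α w)
    (κ₁ := κ₁) (κ₂ := κ₂) (a := α * σ) (L := L) (C := 1 + (κ₂ + 1) / κ₁)
    (fun k => (hgm.comp (hw k)).norm) (fun k ω => norm_nonneg _)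
    (sub_nonneg.2 (ciInf_le hA.bddBelow w₀)) hκ₁0 hκ₂0 (by positivity) hL
    (le_add_of_nonneg_right (by positivity))
    (by rw [mul_add, mul_div_cancel₀ _ hκ₁0.ne']; linarith)
    (by simp [FOMAML.foIterate])
    (fun k => by
      rw [hA.lintegral_foIterate_succ w₀ hξ hind hlaw (φ := fun u => ENNReal.ofReal
        (FOMAML.metaObjective p f α u - ⨅ w, FOMAML.metaObjective p f α w))
        (hFm.sub_const _).ennreal_ofReal k,
        ← lintegral_add_right _ (hYm k)]
      refine (lintegral_mono fun ω => hA.lintegral_foStep_add_le hα hL hρ hσ.le hσt hαL hDin hDout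
        hB' hDβ hB (Nat.ceil_le.1 hB'') (Nat.ceil_le.1 hDβ') hD1 hσB hσtDin hσtB hK.le hσK' hρK'
        hb ht0.le ht1 htb (FOMAML.foIterate g α L ρ w₀ (fun n => ξ n ω) k)).trans_eq ?_
      rw [lintegral_add_right _ measurable_const, lintegral_const, measure_univ, mul_one, mul_pow])
  simpa only [mul_pow] using hstep
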